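/- Let $d\in\{1,2,3\}$ and let $p>1$, with $p<3$ if $d=3$. For $h>0$ and $g\in L^2(h\mathbb Z^d)$ (complex valued), let $\hat g(\xi)=h^d\sum_{a\in h\mathbb Z^d}g(a)e^{-ia\cdot\xi}$ for $\xi\in\mathbb T_h^d=\mathbb R^d/(\frac{2\pi}{h}\mathbb Z^d)$ (the series being summed in $L^2(\mathbb T_h^d)$), let \[ \|g\|_{H^s_h}^2=\frac1{(2\pi)^d}\int_{\mathbb T_h^d}\Big(1+\frac4{h^2}\sum_{j=1}^d\sin^2\Big(\frac{h\xi_j}2\Big)\Big)^s|\hat g(\xi)|^2\,d\xi , \] and let $\|(f,g)\|_{H^2_h\times H^1_h}^2=\|f\|_{H^2_h}^2+\|g\|_{H^1_h}^2$. Let \[ \Delta_h g(a)=\sum_{j=1}^d\frac{g(a+he_j)+g(a-he_j)-2g(a)}{h^2}. \] Then for every $\varepsilon\in(0,1)$ and every $R$ there is a constant $C$, depending only on $d$, $p$, $\varepsilon$ and $R$ (in particular not on $h$, $T$ or the solution), such that the following holds. Let $h>0$, let $(u_0,u_1)\in H^2_h\times H^1_h$ with $\|(u_0,u_1)\|_{H^2_h\times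 H^1_h}\le R$, let $T>0$, and let $(u,\partial_t u)\in C([0,T];H^2_h\times H^1_h)$ be a solution of \[ \partial_t^2u-\Delta_hu+u+|u|^{p-1}u=0\quad\text{on }[0,T]\times h\mathbb Z^d,\qquad u(0)=u_0,\quad \partial_tu(0)=u_1 . \] Then \[ \sup_{t\in[0,T]}\|(u,\partial_tu)(t)\|_{H^2_h\times H^1_h}\le C\cdot\begin{cases}1+T & \text{if } d=1,\\ (1+T)^{\frac1{1-\varepsilon}} & \text{if } d=2,\\ (1+T)^{\frac2{3-p}} & \text{if } d=3.\end{cases} \] -/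

import Mathlib

open MeasureTheory Filter Topology

noncomputable section

namespace DNLKG

/-- Complex valued functions on the lattice `h ℤ^d`, `h > 0`: the value at the lattice point
`a = h n`, with `n ∈ ℤ^d`, is written `g n`. -/
abbrev LatticeFun (d : ℕ) : Type := (Fin d → ℤ) → ℂ

/-- The discrete Laplacian
`Δ_h g (a) = ∑_j (g (a + h e_j) + g (a - h e_j) - 2 g (a)) / h ^ 2`. -/
def laplacian {d : ℕ} (h : ℝ) (g : LatticeFun d) : LatticeFun d := fun n =>
  ∑ j : Fin d, (g (n + Pi.single j 1) + g (n - Pi.single j 1) - 2 * g n) / (h : ℂ) ^ 2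

/-- The fundamental cell `[-π/h, π/h)^d` of the frequency torus
`𝕋_h^d = ℝ^d / ((2π/h) ℤ^d)`. -/
def cell (d : ℕ) (h : ℝ) : Set (Fin d → ℝ) :=
  Set.univ.pi fun _ => Set.Ico (-(Real.pi / h)) (Real.pi / h)

/-- Lebesgue measure `dξ` on the frequency torus `𝕋_h^d`. -/
def torusMeasure (d : ℕ) (h : ℝ) : Measure (Fin d → ℝ) := volume.restrict (cell d h)

instance (d : ℕ) (h : ℝ) : IsFiniteMeasure (torusMeasure d h) := by
  refine ⟨?_⟩
  rw [torusMeasure, Measure.restrict_apply_univ, cell, volume_pi, Measure.pi_pi]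
  exact ENNReal.prod_lt_top fun _ _ => by simp

/-- The character `ξ ↦ e^{-i a · ξ}` for the lattice point `a = h n`. -/
def character {d : ℕ} (h : ℝ) (n : Fin d → ℤ) (ξ : Fin d → ℝ) : ℂ :=
  Complex.exp (-Complex.I * ((∑ j : Fin d, (h * n j) * ξ j : ℝ) : ℂ))

theorem memLp_character {d : ℕ} (h : ℝ) (n : Fin d → ℤ) :
    MemLp (character h n) 2 (torusMeasure d h) := by
  refine MemLp.of_bound (C := 1) (Continuous.aestronglyMeasurable ?_) (ae_of_all _ fun ξ => ?_)
  · unfold character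
    fun_prop
  · rw [character, Complex.norm_exp]
    simp

/-- The discrete Fourier transform `ĝ (ξ) = h^d ∑_{a ∈ h ℤ^d} g (a) e^{-i a · ξ}` of
`g ∈ L^2 (h ℤ^d)`, the series being summed in `L^2 (𝕋_h^d)`. -/
def dft {d : ℕ} (h : ℝ) (g : LatticeFun d) : Lp ℂ 2 (torusMeasure d h) :=
  ∑' n : Fin d → ℤ, (((h ^ d : ℝ) : ℂ) * g n) • (memLp_character h n).toLp (character h n)

/-- The symbol `1 + (4 / h^2) ∑_j sin (h ξ_j / 2)^2` of `1 - Δ_h`. -/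
def symbol {d : ℕ} (h : ℝ) (ξ : Fin d → ℝ) : ℝ :=
  1 + 4 / h ^ 2 * ∑ j : Fin d, Real.sin (h * ξ j / 2) ^ 2

/-- Membership in the discrete Sobolev space `H^s (h ℤ^d)`. -/
def MemSobolev {d : ℕ} (s h : ℝ) (g : LatticeFun d) : Prop :=
  Memℓp g 2 ∧
    Integrable (fun ξ => symbol h ξ ^ s * ‖dft h g ξ‖ ^ 2) (torusMeasure d h)

/-- The norm of the discrete Sobolev space `H^s (h ℤ^d)`. -/
def sobolevNorm {d : ℕ} (s h : ℝ) (g : LatticeFun d) : ℝ :=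
  √(1 / (2 * Real.pi) ^ d *
    ∫ ξ, symbol h ξ ^ s * ‖dft h g ξ‖ ^ 2 ∂torusMeasure d h)

/-- `u ∈ C([0,T]; H^s (h ℤ^d))`. -/
def ContinuousInSobolev {d : ℕ} (s h T : ℝ) (u : ℝ → LatticeFun d) : Prop :=
  (∀ t ∈ Set.Icc 0 T, MemSobolev s h (u t)) ∧
    ∀ t ∈ Set.Icc 0 T,
      Tendsto (fun τ => sobolevNorm s h (u τ - u t)) (𝓝[Set.Icc 0 T] t) (𝓝 0)

/-- The norm of `H^2 (h ℤ^d) × H^1 (h ℤ^d)`. -/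
def phaseNorm {d : ℕ} (h : ℝ) (f g : LatticeFun d) : ℝ :=
  √(sobolevNorm 2 h f ^ 2 + sobolevNorm 1 h g ^ 2)

/-- `(u, v) = (u, ∂_t u) ∈ C([0,T]; H^2_h × H^1_h)` solves
`∂_t^2 u - Δ_h u + u + |u|^{p-1} u = 0` on `[0,T]`, at every point of the lattice,
with `u (0) = u₀` and `∂_t u (0) = u₁`. -/
structure IsSolution {d : ℕ} (p h T : ℝ) (u₀ u₁ : LatticeFun d)
    (u v : ℝ → LatticeFun d) : Prop where
  continuous_fst : ContinuousInSobolev 2 h T u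
  continuous_snd : ContinuousInSobolev 1 h T v
  initial_fst : u 0 = u₀
  initial_snd : v 0 = u₁
  deriv_fst : ∀ t ∈ Set.Icc 0 T, ∀ n,
    HasDerivWithinAt (fun τ => u τ n) (v t n) (Set.Icc 0 T) t
  deriv_snd : ∀ t ∈ Set.Icc 0 T, ∀ n,
    HasDerivWithinAt (fun τ => v τ n)
      (laplacian h (u t) n - u t n - ((‖u t n‖ ^ (p - 1) : ℝ) : ℂ) * u t n) (Set.Icc 0 T) t

/-- The growth exponent: `1` for `d = 1`, `1 / (1 - ε)` for `d = 2`, `2 / (3 - p)` for `d = 3`. -/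
def growthExponent (d : ℕ) (p ε : ℝ) : ℝ :=
  if d = 1 then 1 else if d = 2 then 1 / (1 - ε) else 2 / (3 - p)

end DNLKG

end

/-!
The growth of the `H^2 × H^1` norm follows from three facts, all uniform in the mesh size `h`.

*Energy.* Conservation of the energy `½‖∂_t u‖^2 + ½‖u‖_{H^1}^2 + ∑ |u|^{p+1} / (p+1)`
(`IsStrongSolution.energy_eq`) bounds the `H^1` norm of `u` by a constant `a` for all times
(`IsStrongSolution.gradSq_le`).

*Gagliardo-Nirenberg.* If `‖u‖_{H^1} ≤ a` and `‖u‖_{H^2} ≤ b` then `‖u‖_∞ ≤ K a^{1-θ} b^θ`, with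
`θ = 0` for `d = 1`, any `θ ∈ (0, 1]` for `d = 2`, and `θ = 1/2` for `d = 3`
(`Admissible.exists_norm_apply_le`). Indeed `‖u‖_∞` is at most the `L^1` norm of `û`, and the
Cauchy-Schwarz inequality with weight `w = m / a^2 + m^2 / b^2`, where `m` is the symbol of
`1 - Δ_h`, leaves the integral of `1 / w`, which is at most `K (a^{1-θ} b^θ)^2` because
`m ≥ (1 + |ξ|^2) / 4` on the frequency cell. Using both terms of the weight at once makes the
critical case `d = 3` work without a splitting of frequencies.

*Differential inequality.* With `N = ‖(u, ∂_t u)‖_{H^2 × H^1}`, the linear part conserves `N`, so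
`(N^2)' = -2 Re ⟨∂_t u, |u|^{p-1} u⟩_{H^1}`, and `‖|u|^{p-1} u‖_{H^1} ≤ p ‖u‖_∞^{p-1} ‖u‖_{H^1}`
(`gradSq_powerL2_le`). Hence `N' ≤ C (1 + N)^α` whenever `θ (p - 1) ≤ α`, and if `α < 1` this gives
`N ≤ C (1 + T)^{1 / (1 - α)}` (`exists_phaseSq_le`). The three cases are `α = 0`, `α = ε` and
`α = (p - 1) / 2`.

The norms are transported to the Hilbert space `L2 d` of square summable functions by Parseval's
identity (`sobolevNorm_one_sq`, `sobolevNorm_two_sq`): there `1 - Δ_h` is a bounded operator, and a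
solution with derivatives at each lattice point is differentiable as a curve in `L2 d`
(`IsSolution.isStrongSolution`).
-/

noncomputable section
namespace DNLKG

/-! ### The power nonlinearity -/

/-- The power nonlinearity `z ↦ |z|^{p-1} z`. -/
def power (p : ℝ) (z : ℂ) : ℂ := ((‖z‖ ^ (p - 1) : ℝ) : ℂ) * z

theorem norm_power {p : ℝ} (z : ℂ) : ‖power p z‖ = ‖z‖ ^ (p - 1) * ‖z‖ := by
  rw [power, norm_mul, Complex.norm_real, Real.norm_of_nonneg (by positivity)]

/-- The tangent line inequality for the convex function `x ↦ x ^ (q + 1)` on `[0, ∞)`. -/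
theorem rpow_tangent {q x y : ℝ} (hq : 0 < q) (hx : 0 ≤ x) (hy : 0 ≤ y) :
    y ^ (q + 1) + (q + 1) * y ^ q * (x - y) ≤ x ^ (q + 1) := by
  rcases hy.eq_or_lt with rfl | hy
  · rw [Real.zero_rpow (by linarith), Real.zero_rpow hq.ne']
    simpa using Real.rpow_nonneg hx _
  have hb := one_add_mul_self_le_rpow_one_add (s := x / y - 1) (by
    have : 0 ≤ x / y := by positivity
    linarith) (p := q + 1) (by linarith)
  rw [add_sub_cancel, Real.div_rpow hx hy.le, le_div_iff₀ (by positivity)] at hb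
  have hs : y ^ (q + 1) = y ^ q * y := by rw [Real.rpow_add hy, Real.rpow_one]
  calc y ^ (q + 1) + (q + 1) * y ^ q * (x - y)
      = (1 + (q + 1) * (x / y - 1)) * y ^ (q + 1) := by rw [hs]; field_simp
    _ ≤ _ := hb

theorem norm_power_sub_le_aux {p : ℝ} (hp : 1 < p) {a b : ℂ} (hab : ‖a‖ ≤ ‖b‖) :
    ‖power p a - power p b‖ ≤ p * ‖b‖ ^ (p - 1) * ‖a - b‖ := by
  have ht := rpow_tangent (q := p - 1) (by linarith) (norm_nonneg a) (norm_nonneg b)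
  have e : power p a - power p b = ((‖b‖ ^ (p - 1) : ℝ) : ℂ) * (a - b)
      - ((‖b‖ ^ (p - 1) - ‖a‖ ^ (p - 1) : ℝ) : ℂ) * a := by
    simp only [power]; push_cast; ring
  have hmono : ‖a‖ ^ (p - 1) ≤ ‖b‖ ^ (p - 1) :=
    Real.rpow_le_rpow (norm_nonneg a) hab (by linarith)
  have hadd : ∀ x : ℝ, 0 ≤ x → x ^ (p - 1 + 1) = x ^ (p - 1) * x := fun x hx => by
    rw [Real.rpow_add_one' hx (by linarith)]
  rw [hadd _ (norm_nonneg a), hadd _ (norm_nonneg b)] at ht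
  have hd : ‖b‖ - ‖a‖ ≤ ‖a - b‖ := by
    rw [norm_sub_rev]; exact norm_sub_norm_le b a
  have hB : 0 ≤ ‖b‖ ^ (p - 1) := by positivity
  calc ‖power p a - power p b‖
      ≤ ‖b‖ ^ (p - 1) * ‖a - b‖ + (‖b‖ ^ (p - 1) - ‖a‖ ^ (p - 1)) * ‖a‖ := by
        rw [e]
        refine (norm_sub_le _ _).trans (le_of_eq ?_)
        rw [norm_mul, norm_mul, Complex.norm_real, Complex.norm_real, Real.norm_of_nonneg hB,
          Real.norm_of_nonneg (sub_nonneg.2 hmono)]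
    _ ≤ ‖b‖ ^ (p - 1) * ‖a - b‖ + (p - 1) * ‖b‖ ^ (p - 1) * (‖b‖ - ‖a‖) := by nlinarith
    _ ≤ ‖b‖ ^ (p - 1) * ‖a - b‖ + (p - 1) * ‖b‖ ^ (p - 1) * ‖a - b‖ := by
        gcongr
    _ = _ := by ring

/-- The nonlinearity is Lipschitz on the ball of radius `S`, with constant `p S^{p-1}`. -/
theorem norm_power_sub_le {p S : ℝ} (hp : 1 < p) {a b : ℂ} (ha : ‖a‖ ≤ S) (hb : ‖b‖ ≤ S) :
    ‖power p a - power p b‖ ≤ p * S ^ (p - 1) * ‖a - b‖ := by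
  have key : ∀ c : ℂ, ‖c‖ ≤ S →
      p * ‖c‖ ^ (p - 1) * ‖a - b‖ ≤ p * S ^ (p - 1) * ‖a - b‖ := fun c hc => by
    have := Real.rpow_le_rpow (norm_nonneg c) hc (z := p - 1) (by linarith)
    gcongr
  rcases le_total ‖a‖ ‖b‖ with hab | hab
  · exact (norm_power_sub_le_aux hp hab).trans (key b hb)
  · rw [norm_sub_rev, norm_sub_rev a b]
    rw [norm_sub_rev a b] at key
    exact (norm_power_sub_le_aux hp hab).trans (key a ha)

/-- The potential `|z|^{p+1} / (p+1)` of the nonlinearity. -/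
def potential (p : ℝ) (z : ℂ) : ℝ := ‖z‖ ^ (p + 1) / (p + 1)

theorem potential_nonneg {p : ℝ} (hp : 1 < p) (z : ℂ) : 0 ≤ potential p z := by
  unfold potential; positivity

theorem potential_le {p S : ℝ} (hp : 1 < p) {z : ℂ} (hz : ‖z‖ ≤ S) :
    potential p z ≤ S ^ (p - 1) * ‖z‖ ^ 2 := by
  have h1 : ‖z‖ ^ (p + 1) = ‖z‖ ^ (p - 1) * ‖z‖ ^ 2 := by
    rw [← Real.rpow_natCast, ← Real.rpow_add' (norm_nonneg z) (by norm_num; linarith)]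
    congr 1; norm_num; ring
  have h2 : ‖z‖ ^ (p - 1) ≤ S ^ (p - 1) := Real.rpow_le_rpow (norm_nonneg z) hz (by linarith)
  have h3 : 0 ≤ ‖z‖ ^ (p + 1) := by positivity
  calc potential p z ≤ ‖z‖ ^ (p + 1) := div_le_self h3 (by linarith)
    _ ≤ _ := by rw [h1]; gcongr

/-- The potential is convex with gradient `power p`. -/
theorem potential_tangent {p : ℝ} (hp : 1 < p) (a b : ℂ) :
    potential p a + (inner ℂ (power p a) (b - a)).re ≤ potential p b := by
  have ht := rpow_tangent (q := p) (by linarith) (norm_nonneg b) (norm_nonneg a)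
  have hadd : ∀ x : ℝ, 0 ≤ x → x ^ p = x ^ (p - 1) * x := fun x hx => by
    rw [← Real.rpow_add_one' hx (by linarith)]; ring_nf
  have h1 : inner ℂ (power p a) (b - a)
      = ((‖a‖ ^ (p - 1) : ℝ) : ℂ) * (inner ℂ a b - ((‖a‖ ^ 2 : ℝ) : ℂ)) := by
    have e : power p a = ((‖a‖ ^ (p - 1) : ℝ) : ℂ) • a := rfl
    rw [e, inner_smul_left, inner_sub_right, inner_self_eq_norm_sq_to_K, Complex.conj_ofReal]
    simp
  have h2 : (inner ℂ a b).re ≤ ‖a‖ * ‖b‖ := (Complex.re_le_norm _).trans (norm_inner_le_norm a b)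
  have h3 : 0 ≤ ‖a‖ ^ (p - 1) := by positivity
  rw [h1, Complex.re_ofReal_mul, Complex.sub_re, Complex.ofReal_re, potential, potential]
  have h4 : ‖a‖ ^ (p - 1) * ((inner ℂ a b).re - ‖a‖ ^ 2) ≤ ‖a‖ ^ p * (‖b‖ - ‖a‖) := by
    rw [hadd _ (norm_nonneg a)]; nlinarith
  rw [le_div_iff₀ (by linarith), add_mul, div_mul_cancel₀ _ (by linarith)]
  nlinarith

/-- First order Taylor expansion of the potential, with a quadratic remainder. -/
theorem abs_potential_sub_le {p S : ℝ} (hp : 1 < p) {a b : ℂ} (ha : ‖a‖ ≤ S) (hb : ‖b‖ ≤ S) :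
    |potential p b - potential p a - (inner ℂ (power p a) (b - a)).re|
      ≤ p * S ^ (p - 1) * ‖b - a‖ ^ 2 := by
  have h1 := potential_tangent hp a b
  have h2 := potential_tangent hp b a
  have h3 : (inner ℂ (power p b - power p a) (b - a)).re ≤ p * S ^ (p - 1) * ‖b - a‖ ^ 2 := by
    refine (Complex.re_le_norm _).trans ((norm_inner_le_norm _ _).trans ?_)
    rw [sq, ← mul_assoc]
    gcongr
    exact norm_power_sub_le hp hb ha
  have h4 : (inner ℂ (power p b) (a - b)).re = -(inner ℂ (power p b) (b - a)).re := by
    rw [← neg_sub b a, inner_neg_right, Complex.neg_re]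
  rw [inner_sub_left, Complex.sub_re] at h3
  rw [abs_of_nonneg (by linarith)]
  linarith

/-! ### Square summable lattice functions and the discrete Laplacian -/

/-- The Hilbert space of square summable lattice functions, with the counting measure; the norm of
`L^2 (h ℤ^d)` is `h ^ (d / 2)` times its norm. -/
abbrev L2 (d : ℕ) : Type := lp (fun _ : Fin d → ℤ => ℂ) 2

variable {d : ℕ}

theorem memℓp_two_iff (g : LatticeFun d) : Memℓp g 2 ↔ Summable fun n => ‖g n‖ ^ 2 := by
  rw [memℓp_gen_iff (by simp)]
  simp

theorem L2.summable_sq (x : L2 d) : Summable fun n => ‖x n‖ ^ 2 :=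
  (memℓp_two_iff _).1 x.2

theorem L2.norm_sq_eq (x : L2 d) : ‖x‖ ^ 2 = ∑' n, ‖x n‖ ^ 2 := by
  simpa using lp.norm_rpow_eq_tsum (p := 2) (by simp) x

theorem L2.norm_apply_le (x : L2 d) (n : Fin d → ℤ) : ‖x n‖ ≤ ‖x‖ :=
  lp.norm_apply_le_norm (by simp) x n

theorem L2.norm_le_of_forall_le {K : ℝ} (hK : 0 ≤ K) {x y : L2 d}
    (hxy : ∀ n, ‖y n‖ ≤ K * ‖x n‖) : ‖y‖ ≤ K * ‖x‖ := by
  refine le_of_sq_le_sq ?_ (by positivity)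
  rw [mul_pow, L2.norm_sq_eq, L2.norm_sq_eq, ← tsum_mul_left]
  refine y.summable_sq.tsum_le_tsum (fun n => ?_) (x.summable_sq.mul_left _)
  rw [← mul_pow]
  exact pow_le_pow_left₀ (norm_nonneg _) (hxy n) 2

theorem memℓp_of_forall_le {K : ℝ} {g : LatticeFun d} (x : L2 d)
    (hg : ∀ n, ‖g n‖ ≤ K * ‖x n‖) : Memℓp g 2 := by
  rw [memℓp_two_iff]
  refine (x.summable_sq.mul_left (K ^ 2)).of_nonneg_of_le (fun n => by positivity) fun n => ?_
  rw [← mul_pow]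
  exact pow_le_pow_left₀ (norm_nonneg _) (hg n) 2

theorem memℓp_shift (k : Fin d → ℤ) {g : LatticeFun d} (hg : Memℓp g 2) :
    Memℓp (fun n => g (n + k)) 2 := by
  rw [memℓp_two_iff] at *
  exact hg.comp_injective (add_left_injective k)

/-- Translation by the lattice vector `h k`. -/
def shift (k : Fin d → ℤ) : L2 d →ₗᵢ[ℂ] L2 d where
  toFun x := ⟨fun n => x (n + k), memℓp_shift k x.2⟩
  map_add' _ _ := rfl
  map_smul' _ _ := rfl
  norm_map' x := by
    refine (sq_eq_sq₀ (norm_nonneg _) (norm_nonneg _)).1 ?_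
    rw [L2.norm_sq_eq, L2.norm_sq_eq]
    exact (Equiv.addRight k).tsum_eq fun n => ‖x n‖ ^ 2

theorem shift_apply (k : Fin d → ℤ) (x : L2 d) (n : Fin d → ℤ) : shift k x n = x (n + k) := rfl

theorem shift_shift_neg (k : Fin d → ℤ) (x : L2 d) : shift k (shift (-k) x) = x := by
  ext n
  simp [shift_apply]

theorem inner_shift_neg (k : Fin d → ℤ) (x y : L2 d) :
    inner ℂ (shift (-k) x) y = inner ℂ x (shift k y) := by
  rw [← (shift k).inner_map_map, shift_shift_neg]

/-- The forward difference quotient in the `j`-th direction. -/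
def diff (h : ℝ) (j : Fin d) : L2 d →L[ℂ] L2 d :=
  (h : ℂ)⁻¹ • ((shift (Pi.single j 1)).toContinuousLinearMap - 1)

theorem diff_eq (h : ℝ) (j : Fin d) (x : L2 d) :
    diff h j x = (h : ℂ)⁻¹ • (shift (Pi.single j 1) x - x) := rfl

theorem diff_apply (h : ℝ) (j : Fin d) (x : L2 d) (n : Fin d → ℤ) :
    diff h j x n = (h : ℂ)⁻¹ * (x (n + Pi.single j 1) - x n) := rfl

/-- The Klein-Gordon operator `1 - Δ_h` on `L2 d`. -/
def kleinGordon (h : ℝ) : L2 d →L[ℂ] L2 d :=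
  1 - ∑ j : Fin d, ((h : ℂ) ^ 2)⁻¹ • ((shift (Pi.single j 1)).toContinuousLinearMap
    + (shift (-Pi.single j 1)).toContinuousLinearMap - (2 : ℂ) • 1)

theorem kleinGordon_eq (h : ℝ) (x : L2 d) :
    kleinGordon h x = x - ∑ j : Fin d, ((h : ℂ) ^ 2)⁻¹ •
      (shift (Pi.single j 1) x + shift (-Pi.single j 1) x - (2 : ℂ) • x) := by
  simp [kleinGordon]

theorem kleinGordon_apply (h : ℝ) (x : L2 d) (n : Fin d → ℤ) :
    kleinGordon h x n = x n - laplacian h x n := by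
  rw [kleinGordon_eq, lp.coeFn_sub, Pi.sub_apply, lp.coeFn_sum, Finset.sum_apply, laplacian]
  congr 1
  refine Finset.sum_congr rfl fun j _ => ?_
  rw [lp.coeFn_smul, Pi.smul_apply, lp.coeFn_sub, lp.coeFn_add, lp.coeFn_smul]
  simp only [Pi.sub_apply, Pi.add_apply, Pi.smul_apply, shift_apply, smul_eq_mul]
  rw [← sub_eq_add_neg, div_eq_inv_mul]

theorem inner_diff_diff (h : ℝ) (j : Fin d) (x y : L2 d) :
    inner ℂ (diff h j x) (diff h j y) = -(((h : ℂ) ^ 2)⁻¹ *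
      inner ℂ (shift (Pi.single j 1) x + shift (-Pi.single j 1) x - (2 : ℂ) • x) y) := by
  simp only [diff_eq, inner_smul_left, inner_smul_right, inner_sub_left, inner_sub_right,
    inner_add_left, inner_shift_neg, LinearIsometry.inner_map_map, map_inv₀, Complex.conj_ofReal,
    map_ofNat]
  ring

/-- Summation by parts: `1 - Δ_h = 1 + ∑_j D_j^* D_j`. -/
theorem inner_kleinGordon (h : ℝ) (x y : L2 d) :
    inner ℂ (kleinGordon h x) y
      = inner ℂ x y + ∑ j : Fin d, inner ℂ (diff h j x) (diff h j y) := by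
  rw [kleinGordon_eq, inner_sub_left, sum_inner, sub_eq_add_neg, ← Finset.sum_neg_distrib]
  congr 1
  refine Finset.sum_congr rfl fun j _ => ?_
  rw [inner_diff_diff, inner_smul_left, map_inv₀, map_pow, Complex.conj_ofReal]

theorem inner_kleinGordon_comm (h : ℝ) (x y : L2 d) :
    inner ℂ (kleinGordon h x) y = inner ℂ x (kleinGordon h y) := by
  rw [← inner_conj_symm x, inner_kleinGordon, inner_kleinGordon, map_add, map_sum]
  simp only [inner_conj_symm]

/-- The square of the `H^1` norm, up to the factor `h ^ d`. -/
def gradSq (h : ℝ) (x : L2 d) : ℝ := (inner ℂ (kleinGordon h x) x).re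

theorem gradSq_eq (h : ℝ) (x : L2 d) :
    gradSq h x = ‖x‖ ^ 2 + ∑ j : Fin d, ‖diff h j x‖ ^ 2 := by
  rw [gradSq, inner_kleinGordon, Complex.add_re, Complex.re_sum]
  simp only [inner_self_eq_norm_sq_to_K]
  norm_cast

theorem norm_sq_le_gradSq (h : ℝ) (x : L2 d) : ‖x‖ ^ 2 ≤ gradSq h x := by
  rw [gradSq_eq]
  exact le_add_of_nonneg_right (Finset.sum_nonneg fun j _ => by positivity)

theorem gradSq_nonneg (h : ℝ) (x : L2 d) : 0 ≤ gradSq h x :=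
  (sq_nonneg _).trans (norm_sq_le_gradSq h x)

/-- The Cauchy-Schwarz inequality for the `H^1` inner product. -/
theorem abs_re_inner_kleinGordon_le (h : ℝ) (x y : L2 d) :
    |(inner ℂ (kleinGordon h x) y).re| ≤ √(gradSq h x) * √(gradSq h y) := by
  have hq : ∀ t : ℝ, 0 ≤ gradSq h y * (t * t)
      + (2 * (inner ℂ (kleinGordon h x) y).re) * t + gradSq h x := fun t => by
    have ht := gradSq_nonneg h (x + (t : ℂ) • y)
    have hs : (inner ℂ (kleinGordon h y) x).re = (inner ℂ (kleinGordon h x) y).re := by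
      rw [inner_kleinGordon_comm, ← inner_conj_symm, Complex.conj_re]
    rw [gradSq] at ht
    simp only [map_add, map_smul, inner_add_left, inner_add_right, inner_smul_left,
      inner_smul_right, Complex.conj_ofReal, Complex.add_re, Complex.re_ofReal_mul, hs] at ht
    rw [gradSq, gradSq]
    linarith
  have hd := discrim_le_zero hq
  rw [discrim] at hd
  rw [← Real.sqrt_mul (gradSq_nonneg h x)]
  refine Real.abs_le_sqrt ?_
  linarith

theorem norm_le_norm_kleinGordon (h : ℝ) (x : L2 d) : ‖x‖ ≤ ‖kleinGordon h x‖ := by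
  rcases (norm_nonneg x).eq_or_lt with h0 | h0
  · rw [← h0]; exact norm_nonneg _
  have h1 : ‖x‖ ^ 2 ≤ ‖kleinGordon h x‖ * ‖x‖ :=
    (norm_sq_le_gradSq h x).trans ((Complex.re_le_norm _).trans (norm_inner_le_norm _ _))
  nlinarith

theorem gradSq_le_norm_kleinGordon_sq (h : ℝ) (x : L2 d) :
    gradSq h x ≤ ‖kleinGordon h x‖ ^ 2 := by
  refine (Complex.re_le_norm _).trans ((norm_inner_le_norm _ _).trans ?_)
  rw [sq]
  gcongr
  exact norm_le_norm_kleinGordon h x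

/-! ### The nonlinearity on square summable functions -/

theorem norm_power_le {p S : ℝ} (hp : 1 < p) {z : ℂ} (hz : ‖z‖ ≤ S) :
    ‖power p z‖ ≤ S ^ (p - 1) * ‖z‖ := by
  rw [norm_power]
  gcongr

/-- The nonlinearity `|x|^{p-1} x` as a map of `L2 d` into itself; it is set to `0` for `p ≤ 1`. -/
def powerL2 (p : ℝ) (x : L2 d) : L2 d :=
  if hp : 1 < p then ⟨fun n => power p (x n), memℓp_of_forall_le x fun n =>
    norm_power_le hp (x.norm_apply_le n)⟩ else 0

theorem powerL2_apply {p : ℝ} (hp : 1 < p) (x : L2 d) (n : Fin d → ℤ) :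
    powerL2 p x n = power p (x n) := by
  rw [powerL2, dif_pos hp]

theorem norm_powerL2_sub_le {p S : ℝ} (hp : 1 < p) {x y : L2 d} (hx : ‖x‖ ≤ S) (hy : ‖y‖ ≤ S) :
    ‖powerL2 p x - powerL2 p y‖ ≤ p * S ^ (p - 1) * ‖x - y‖ := by
  have hS : 0 ≤ S := (norm_nonneg x).trans hx
  refine L2.norm_le_of_forall_le (by positivity) fun n => ?_
  rw [lp.coeFn_sub, lp.coeFn_sub, Pi.sub_apply, Pi.sub_apply, powerL2_apply hp, powerL2_apply hp]
  exact norm_power_sub_le hp ((x.norm_apply_le n).trans hx) ((y.norm_apply_le n).trans hy)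

theorem continuous_powerL2 {p : ℝ} (hp : 1 < p) : Continuous (powerL2 p : L2 d → L2 d) := by
  refine continuous_iff_continuousAt.2 fun x => ?_
  rw [ContinuousAt, tendsto_iff_norm_sub_tendsto_zero]
  have hlim : Tendsto (fun y : L2 d => p * (‖x‖ + 1) ^ (p - 1) * ‖y - x‖) (𝓝 x) (𝓝 0) := by
    have : Continuous fun y : L2 d => p * (‖x‖ + 1) ^ (p - 1) * ‖y - x‖ := by fun_prop
    simpa using this.tendsto x
  refine squeeze_zero' (Eventually.of_forall fun y => norm_nonneg _) ?_ hlim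
  filter_upwards [Metric.ball_mem_nhds x one_pos] with y hy
  rw [mem_ball_iff_norm] at hy
  refine norm_powerL2_sub_le hp ?_ (by linarith)
  linarith [norm_sub_norm_le y x]

/-- The nonlinearity is bounded on `H^1`, with the sup norm of `x` in the constant. -/
theorem gradSq_powerL2_le (h : ℝ) {p S : ℝ} (hp : 1 < p) {x : L2 d} (hx : ∀ n, ‖x n‖ ≤ S) :
    gradSq h (powerL2 p x) ≤ (p * S ^ (p - 1)) ^ 2 * gradSq h x := by
  have hS : 0 ≤ S := (norm_nonneg _).trans (hx 0)
  have hK : 0 ≤ p * S ^ (p - 1) := by positivity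
  have h0 : ‖powerL2 p x‖ ≤ p * S ^ (p - 1) * ‖x‖ := L2.norm_le_of_forall_le hK fun n => by
    rw [powerL2_apply hp]
    refine (norm_power_le hp (hx n)).trans ?_
    gcongr
    exact le_mul_of_one_le_left (by positivity) hp.le
  have h1 : ∀ j, ‖diff h j (powerL2 p x)‖ ≤ p * S ^ (p - 1) * ‖diff h j x‖ := fun j =>
    L2.norm_le_of_forall_le hK fun n => by
      rw [diff_apply, diff_apply, norm_mul, norm_mul, mul_left_comm, powerL2_apply hp,
        powerL2_apply hp]
      gcongr
      exact norm_power_sub_le hp (hx _) (hx _)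
  rw [gradSq_eq, gradSq_eq, mul_add, Finset.mul_sum, ← mul_pow]
  simp only [← mul_pow]
  gcongr with j
  exact h1 j

/-- The potential energy `∑_n |x_n|^{p+1} / (p+1)`. -/
def potentialSum (p : ℝ) (x : L2 d) : ℝ := ∑' n, potential p (x n)

theorem summable_potential {p : ℝ} (hp : 1 < p) (x : L2 d) :
    Summable fun n => potential p (x n) :=
  (x.summable_sq.mul_left _).of_nonneg_of_le (fun _ => potential_nonneg hp _) fun n =>
    potential_le hp (x.norm_apply_le n)

theorem potentialSum_nonneg {p : ℝ} (hp : 1 < p) (x : L2 d) : 0 ≤ potentialSum p x :=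
  tsum_nonneg fun _ => potential_nonneg hp _

theorem potentialSum_le {p S : ℝ} (hp : 1 < p) {x : L2 d} (hx : ∀ n, ‖x n‖ ≤ S) :
    potentialSum p x ≤ S ^ (p - 1) * ‖x‖ ^ 2 := by
  rw [L2.norm_sq_eq, ← tsum_mul_left]
  exact (summable_potential hp x).tsum_le_tsum (fun n => potential_le hp (hx n))
    (x.summable_sq.mul_left _)

theorem abs_potentialSum_sub_le {p S : ℝ} (hp : 1 < p) {x y : L2 d} (hx : ‖x‖ ≤ S)
    (hy : ‖y‖ ≤ S) :
    |potentialSum p y - potentialSum p x - (inner ℂ (powerL2 p x) (y - x)).re|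
      ≤ p * S ^ (p - 1) * ‖y - x‖ ^ 2 := by
  have hre := Complex.hasSum_re (lp.hasSum_inner (𝕜 := ℂ) (powerL2 p x) (y - x))
  have hs := ((summable_potential hp y).hasSum.sub (summable_potential hp x).hasSum).sub hre
  have hq := ((y - x).summable_sq.hasSum).mul_left (p * S ^ (p - 1))
  rw [← L2.norm_sq_eq] at hq
  have hb : ∀ n, ‖potential p (y n) - potential p (x n)
      - (inner ℂ (powerL2 p x n) ((y - x) n)).re‖ ≤ p * S ^ (p - 1) * ‖(y - x) n‖ ^ 2 := fun n => by
    rw [powerL2_apply hp]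
    exact abs_potential_sub_le hp ((x.norm_apply_le n).trans hx) ((y.norm_apply_le n).trans hy)
  have := tsum_of_norm_bounded hq hb
  rwa [hs.tsum_eq] at this

/-! ### The discrete Fourier transform -/

/-- The character of the lattice point `h n` as an element of `L^2 (𝕋_h^d)`. -/
def characterLp (h : ℝ) (n : Fin d → ℤ) : Lp ℂ 2 (torusMeasure d h) :=
  (memLp_character h n).toLp (character h n)

theorem character_add (h : ℝ) (m n : Fin d → ℤ) (ξ : Fin d → ℝ) :
    character h (m + n) ξ = character h m ξ * character h n ξ := by
  rw [character, character, character, ← Complex.exp_add, ← mul_add, ← Complex.ofReal_add,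
    ← Finset.sum_add_distrib]
  simp only [Pi.add_apply, Int.cast_add, mul_add, add_mul]

theorem conj_character (h : ℝ) (n : Fin d → ℤ) (ξ : Fin d → ℝ) :
    starRingEnd ℂ (character h n ξ) = character h (-n) ξ := by
  rw [character, character, ← Complex.exp_conj, map_mul, Complex.conj_ofReal, map_neg,
    Complex.conj_I, neg_neg]
  simp

theorem norm_character (h : ℝ) (n : Fin d → ℤ) (ξ : Fin d → ℝ) : ‖character h n ξ‖ = 1 := by
  rw [character, Complex.norm_exp]
  simp

theorem continuous_character (h : ℝ) (n : Fin d → ℤ) : Continuous (character h n) := by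
  unfold character
  fun_prop

theorem torusMeasure_eq_pi (d : ℕ) (h : ℝ) :
    torusMeasure d h = Measure.pi fun _ : Fin d =>
      volume.restrict (Set.Ico (-(Real.pi / h)) (Real.pi / h)) := by
  rw [torusMeasure, cell, volume_pi, Measure.restrict_pi_pi]

theorem integral_exp_Ico {h : ℝ} (hh : 0 < h) (k : ℤ) :
    ∫ x in Set.Ico (-(Real.pi / h)) (Real.pi / h), Complex.exp (-Complex.I * ((h * k * x : ℝ) : ℂ))
      = if k = 0 then ((2 * Real.pi / h : ℝ) : ℂ) else 0 := by
  have hpi := Real.pi_pos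
  have hle : -(Real.pi / h) ≤ Real.pi / h := by
    have : 0 ≤ Real.pi / h := by positivity
    linarith
  rw [integral_Ico_eq_integral_Ioc, ← intervalIntegral.integral_of_le hle]
  split_ifs with hk
  · subst hk
    simp only [Int.cast_zero, mul_zero, zero_mul, Complex.ofReal_zero, Complex.exp_zero,
      intervalIntegral.integral_const, Complex.real_smul, mul_one]
    congr 1
    ring
  · have hc : (-Complex.I * h * k : ℂ) ≠ 0 := by
      simp [hh.ne', hk]
    have e : ∀ x : ℝ, -Complex.I * ((h * k * x : ℝ) : ℂ) = (-Complex.I * h * k) * x := fun x => by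
      push_cast; ring
    simp only [e]
    rw [integral_exp_mul_complex hc, div_eq_zero_iff]
    left
    rw [sub_eq_zero, Complex.exp_eq_exp_iff_exists_int]
    refine ⟨-k, ?_⟩
    have hh' : (h : ℂ) ≠ 0 := by exact_mod_cast hh.ne'
    push_cast
    field_simp
    ring

theorem integral_character {h : ℝ} (hh : 0 < h) (n : Fin d → ℤ) :
    ∫ ξ, character h n ξ ∂torusMeasure d h
      = if n = 0 then (((2 * Real.pi / h) ^ d : ℝ) : ℂ) else 0 := by
  have e : ∀ ξ : Fin d → ℝ, character h n ξ
      = ∏ j, Complex.exp (-Complex.I * ((h * n j * ξ j : ℝ) : ℂ)) := fun ξ => by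
    rw [character, ← Complex.exp_sum, ← Finset.mul_sum, Complex.ofReal_sum]
  simp only [e]
  rw [torusMeasure_eq_pi, integral_fintype_prod_eq_prod (𝕜 := ℂ)
    (fun j (x : ℝ) => Complex.exp (-Complex.I * ((h * n j * x : ℝ) : ℂ)))]
  simp only [integral_exp_Ico hh]
  split_ifs with hn
  · subst hn
    simp [div_pow]
  · obtain ⟨j, hj⟩ := Function.ne_iff.1 hn
    exact Finset.prod_eq_zero (Finset.mem_univ j) (if_neg hj)

theorem inner_characterLp_left (h : ℝ) (n : Fin d → ℤ) (f : Lp ℂ 2 (torusMeasure d h)) :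
    inner ℂ (characterLp h n) f = ∫ ξ, character h (-n) ξ * f ξ ∂torusMeasure d h := by
  rw [MeasureTheory.L2.inner_def]
  refine integral_congr_ae ?_
  filter_upwards [(memLp_character h n).coeFn_toLp] with ξ hξ
  rw [characterLp, hξ, RCLike.inner_apply, conj_character, mul_comm]

theorem inner_characterLp {h : ℝ} (hh : 0 < h) (m n : Fin d → ℤ) :
    inner ℂ (characterLp h m) (characterLp h n)
      = if m = n then (((2 * Real.pi / h) ^ d : ℝ) : ℂ) else 0 := by
  have e : (∫ ξ, character h (-m) ξ * characterLp h n ξ ∂torusMeasure d h)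
      = ∫ ξ, character h (-m + n) ξ ∂torusMeasure d h := by
    refine integral_congr_ae ?_
    filter_upwards [(memLp_character h n).coeFn_toLp] with ξ hξ
    rw [characterLp, hξ, character_add]
  rw [inner_characterLp_left, e, integral_character hh]
  simp only [neg_add_eq_zero]

/-- The characters, normalized in `L^2 (𝕋_h^d)`, are orthonormal. -/
theorem orthonormal_character {h : ℝ} (hh : 0 < h) :
    Orthonormal ℂ fun n : Fin d → ℤ =>
      (((√((2 * Real.pi / h) ^ d))⁻¹ : ℝ) : ℂ) • characterLp h n := by
  have hpos : 0 < (2 * Real.pi / h) ^ d := by have := Real.pi_pos; positivity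
  rw [orthonormal_iff_ite]
  intro m n
  rw [inner_smul_left, inner_smul_right, inner_characterLp hh, Complex.conj_ofReal]
  split_ifs
  · rw [← Complex.ofReal_mul, ← Complex.ofReal_mul, ← mul_assoc, ← mul_inv,
      Real.mul_self_sqrt hpos.le, inv_mul_cancel₀ hpos.ne', Complex.ofReal_one]
  · simp

/-- The Fourier series of a square summable function converges, and the transform is a multiple of
an isometry. -/
theorem exists_isometry_dft {h : ℝ} (hh : 0 < h) :
    ∃ I : L2 d →ₗᵢ[ℂ] Lp ℂ 2 (torusMeasure d h), ∀ x : L2 d,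
      dft h x = ((h ^ d * √((2 * Real.pi / h) ^ d) : ℝ) : ℂ) • I x ∧
      HasSum (fun n => (((h ^ d : ℝ) : ℂ) * x n) • characterLp h n) (dft h x) := by
  have hpos : 0 < √((2 * Real.pi / h) ^ d) := by have := Real.pi_pos; positivity
  let hV := (orthonormal_character (d := d) hh).orthogonalFamily
  refine ⟨hV.linearIsometry, fun x => ?_⟩
  have hs := (hV.hasSum_linearIsometry x).const_smul
    ((h ^ d * √((2 * Real.pi / h) ^ d) : ℝ) : ℂ)
  have e : (fun n => ((h ^ d * √((2 * Real.pi / h) ^ d) : ℝ) : ℂ) •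
      (LinearIsometry.toSpanSingleton ℂ _ ((orthonormal_character (d := d) hh).1 n)) (x n))
      = fun n => (((h ^ d : ℝ) : ℂ) * x n) • characterLp h n := by
    funext n
    rw [LinearIsometry.toSpanSingleton_apply, smul_smul, smul_smul]
    congr 1
    have : ((√((2 * Real.pi / h) ^ d) : ℝ) : ℂ) ≠ 0 := by exact_mod_cast hpos.ne'
    push_cast
    field_simp
  rw [e] at hs
  have hd : dft h x = ((h ^ d * √((2 * Real.pi / h) ^ d) : ℝ) : ℂ) • hV.linearIsometry x :=
    hs.tsum_eq
  exact ⟨hd, hd ▸ hs⟩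

theorem hasSum_dft {h : ℝ} (hh : 0 < h) (x : L2 d) :
    HasSum (fun n => (((h ^ d : ℝ) : ℂ) * x n) • characterLp h n) (dft h x) := by
  obtain ⟨I, hI⟩ := exists_isometry_dft (d := d) hh
  exact (hI x).2

theorem dft_add {h : ℝ} (hh : 0 < h) (x y : L2 d) :
    dft h (x + y : L2 d) = dft h x + dft h y := by
  obtain ⟨I, hI⟩ := exists_isometry_dft (d := d) hh
  rw [(hI _).1, (hI x).1, (hI y).1, map_add, smul_add]

theorem dft_smul {h : ℝ} (hh : 0 < h) (c : ℂ) (x : L2 d) :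
    dft h (c • x : L2 d) = c • dft h x := by
  obtain ⟨I, hI⟩ := exists_isometry_dft (d := d) hh
  rw [(hI _).1, (hI x).1, map_smul, smul_comm]

/-- Parseval's identity. -/
theorem inner_dft {h : ℝ} (hh : 0 < h) (x y : L2 d) :
    inner ℂ (dft h x) (dft h y) = (((2 * Real.pi) ^ d * h ^ d : ℝ) : ℂ) * inner ℂ x y := by
  obtain ⟨I, hI⟩ := exists_isometry_dft (d := d) hh
  have hpos : 0 ≤ (2 * Real.pi / h) ^ d := by have := Real.pi_pos; positivity
  rw [(hI x).1, (hI y).1, inner_smul_left, inner_smul_right, I.inner_map_map, Complex.conj_ofReal,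
    ← mul_assoc, ← Complex.ofReal_mul, mul_mul_mul_comm, Real.mul_self_sqrt hpos, div_pow]
  congr 2
  field_simp

/-- Fourier inversion. -/
theorem inner_characterLp_dft {h : ℝ} (hh : 0 < h) (x : L2 d) (n : Fin d → ℤ) :
    inner ℂ (characterLp h n) (dft h x) = (((2 * Real.pi) ^ d : ℝ) : ℂ) * x n := by
  have hs := (hasSum_dft hh x).mapL (innerSL ℂ (characterLp h n))
  simp only [innerSL_apply_apply, inner_smul_right, inner_characterLp hh] at hs
  have h1 := hs.unique (hasSum_single n fun m hm => by rw [if_neg (Ne.symm hm), mul_zero])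
  rw [h1, if_pos rfl, div_pow]
  have : (h : ℂ) ≠ 0 := by exact_mod_cast hh.ne'
  push_cast
  field_simp

/-- Translations act on the Fourier side as multiplication by a character. -/
theorem dft_shift {h : ℝ} (hh : 0 < h) (k : Fin d → ℤ) (x : L2 d) :
    dft h (shift k x) =ᵐ[torusMeasure d h] fun ξ => character h (-k) ξ * dft h x ξ := by
  have hm : MemLp (character h (-k)) ⊤ (torusMeasure d h) :=
    memLp_top_of_bound (continuous_character h _).aestronglyMeasurable 1
      (ae_of_all _ fun ξ => (norm_character h _ ξ).le)
  let M : Lp ℂ 2 (torusMeasure d h) →L[ℂ] Lp ℂ 2 (torusMeasure d h) :=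
    (ContinuousLinearMap.mul ℂ ℂ).holderL (torusMeasure d h) ⊤ 2 2 (hm.toLp _)
  have hM : ∀ f : Lp ℂ 2 (torusMeasure d h),
      M f =ᵐ[torusMeasure d h] fun ξ => character h (-k) ξ * f ξ := fun f => by
    filter_upwards [(ContinuousLinearMap.mul ℂ ℂ).coeFn_holder (r := 2) (hm.toLp _) f,
      hm.coeFn_toLp] with ξ h1 h2
    rw [← h2]
    exact h1
  have hMχ : ∀ n, M (characterLp h n) = characterLp h (n - k) := fun n => by
    refine Lp.ext ?_
    filter_upwards [hM (characterLp h n), (memLp_character h n).coeFn_toLp,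
      (memLp_character h (n - k)).coeFn_toLp] with ξ h1 h2 h3
    rw [h1, characterLp, characterLp, h2, h3, ← character_add, neg_add_eq_sub]
  have hs := (hasSum_dft hh x).mapL M
  simp only [map_smul, hMχ] at hs
  have hs' := (Equiv.addRight k).hasSum_iff.2 hs
  have hfun : ((fun n => (((h ^ d : ℝ) : ℂ) * x n) • characterLp h (n - k)) ∘ (Equiv.addRight k))
      = fun n => (((h ^ d : ℝ) : ℂ) * shift k x n) • characterLp h n := by
    funext n
    simp [shift_apply]
  rw [hfun] at hs'
  rw [(hasSum_dft hh (shift k x)).unique hs']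
  exact hM _

theorem one_le_symbol (h : ℝ) (ξ : Fin d → ℝ) : 1 ≤ symbol h ξ := by
  rw [symbol]
  exact le_add_of_nonneg_right (mul_nonneg (by positivity)
    (Finset.sum_nonneg fun j _ => sq_nonneg _))

theorem symbol_pos (h : ℝ) (ξ : Fin d → ℝ) : 0 < symbol h ξ :=
  one_pos.trans_le (one_le_symbol h ξ)

theorem continuous_symbol (h : ℝ) : Continuous (symbol h : (Fin d → ℝ) → ℝ) := by
  unfold symbol
  fun_prop

theorem symbol_eq (h : ℝ) (ξ : Fin d → ℝ) :
    (symbol h ξ : ℂ) = 1 - ∑ j : Fin d, ((h : ℂ) ^ 2)⁻¹ *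
      (character h (-Pi.single j 1) ξ + character h (Pi.single j 1) ξ - 2) := by
  have hc : ∀ j : Fin d, character h (-Pi.single j 1) ξ + character h (Pi.single j 1) ξ - 2
      = -(4 * ((Real.sin (h * ξ j / 2) ^ 2 : ℝ) : ℂ)) := fun j => by
    have e : ∑ i : Fin d, (h * ((Pi.single j 1 : Fin d → ℤ) i : ℝ)) * ξ i = h * ξ j := by
      rw [Finset.sum_eq_single j]
      · simp
      · intro i _ hij
        simp [Pi.single_eq_of_ne hij]
      · simp
    rw [← conj_character, add_comm, Complex.add_conj, character, e, neg_mul, mul_comm Complex.I,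
      ← neg_mul, ← Complex.ofReal_neg, Complex.exp_ofReal_mul_I_re, Real.cos_neg,
      ← mul_div_cancel₀ (h * ξ j) (two_ne_zero' ℝ), Real.cos_two_mul_eq_one_sub]
    push_cast
    rw [mul_div_cancel_left₀ _ (two_ne_zero' ℂ)]
    ring
  simp only [hc]
  rw [symbol, Finset.mul_sum, sub_eq_add_neg, ← Finset.sum_neg_distrib]
  push_cast
  congr 1
  refine Finset.sum_congr rfl fun j _ => ?_
  ring

/-- The operator `1 - Δ_h` is the Fourier multiplier with symbol `symbol h`. -/
theorem dft_kleinGordon {h : ℝ} (hh : 0 < h) (x : L2 d) :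
    dft h (kleinGordon h x) =ᵐ[torusMeasure d h] fun ξ => (symbol h ξ : ℂ) * dft h x ξ := by
  let D : L2 d →ₗ[ℂ] Lp ℂ 2 (torusMeasure d h) :=
    { toFun := fun x => dft h x, map_add' := dft_add hh, map_smul' := dft_smul hh }
  have e : dft h (kleinGordon h x) = dft h x - ∑ j : Fin d, ((h : ℂ) ^ 2)⁻¹ •
      (dft h (shift (Pi.single j 1) x) + dft h (shift (-Pi.single j 1) x)
        - (2 : ℂ) • dft h x) := by
    change D (kleinGordon h x) = D x - ∑ j : Fin d, ((h : ℂ) ^ 2)⁻¹ •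
      (D (shift (Pi.single j 1) x) + D (shift (-Pi.single j 1) x) - (2 : ℂ) • D x)
    rw [kleinGordon_eq, map_sub, map_sum]
    simp only [map_smul, map_sub, map_add]
  rw [e]
  have hj : ∀ j : Fin d, ∀ᵐ ξ ∂torusMeasure d h, (((h : ℂ) ^ 2)⁻¹ •
      (dft h (shift (Pi.single j 1) x) + dft h (shift (-Pi.single j 1) x)
        - (2 : ℂ) • dft h x) : Lp ℂ 2 (torusMeasure d h)) ξ = ((h : ℂ) ^ 2)⁻¹ *
      (character h (-Pi.single j 1) ξ + character h (Pi.single j 1) ξ - 2) * dft h x ξ := by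
    intro j
    have h1 := dft_shift hh (Pi.single j 1) x
    have h2 := dft_shift hh (-Pi.single j 1) x
    rw [neg_neg] at h2
    filter_upwards [h1, h2, Lp.coeFn_smul ((h : ℂ) ^ 2)⁻¹
      (dft h (shift (Pi.single j 1) x) + dft h (shift (-Pi.single j 1) x) - (2 : ℂ) • dft h x),
      Lp.coeFn_sub (dft h (shift (Pi.single j 1) x) + dft h (shift (-Pi.single j 1) x))
        ((2 : ℂ) • dft h x),
      Lp.coeFn_add (dft h (shift (Pi.single j 1) x)) (dft h (shift (-Pi.single j 1) x)),
      Lp.coeFn_smul (2 : ℂ) (dft h x)] with ξ a1 a2 a3 a4 a5 a6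
    rw [a3, Pi.smul_apply, a4, Pi.sub_apply, a5, Pi.add_apply, a6, Pi.smul_apply, a1, a2,
      smul_eq_mul, smul_eq_mul]
    ring
  filter_upwards [ae_all_iff.2 hj, Lp.coeFn_sub (dft h x) (∑ j : Fin d, ((h : ℂ) ^ 2)⁻¹ •
      (dft h (shift (Pi.single j 1) x) + dft h (shift (-Pi.single j 1) x)
        - (2 : ℂ) • dft h x)), Lp.coeFn_fun_finsetSum (μ := torusMeasure d h) (p := 2)
      Finset.univ (fun j : Fin d => ((h : ℂ) ^ 2)⁻¹ •
      (dft h (shift (Pi.single j 1) x) + dft h (shift (-Pi.single j 1) x)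
        - (2 : ℂ) • dft h x))] with ξ h1 h2 h3
  rw [h2, Pi.sub_apply, h3, symbol_eq, sub_mul, one_mul, Finset.sum_mul]
  congr 1
  exact Finset.sum_congr rfl fun j _ => h1 j

theorem integral_norm_sq_dft {h : ℝ} (hh : 0 < h) (x : L2 d) :
    ∫ ξ, ‖dft h x ξ‖ ^ 2 ∂torusMeasure d h = (2 * Real.pi) ^ d * (h ^ d * ‖x‖ ^ 2) := by
  have h1 := inner_dft hh x x
  rw [MeasureTheory.L2.inner_def] at h1
  simp only [inner_self_eq_norm_sq_to_K] at h1
  have h2 : ((∫ ξ, ‖dft h x ξ‖ ^ 2 ∂torusMeasure d h : ℝ) : ℂ)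
      = (((2 * Real.pi) ^ d * (h ^ d * ‖x‖ ^ 2) : ℝ) : ℂ) := by
    rw [← integral_complex_ofReal]
    simpa [mul_assoc] using h1
  exact_mod_cast h2

theorem integral_symbol_mul_norm_sq_dft {h : ℝ} (hh : 0 < h) (x : L2 d) :
    ∫ ξ, symbol h ξ * ‖dft h x ξ‖ ^ 2 ∂torusMeasure d h
      = (2 * Real.pi) ^ d * (h ^ d * gradSq h x) := by
  have h1 := inner_dft hh (kleinGordon h x) x
  rw [MeasureTheory.L2.inner_def] at h1
  have h2 : ((∫ ξ, symbol h ξ * ‖dft h x ξ‖ ^ 2 ∂torusMeasure d h : ℝ) : ℂ)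
      = (((2 * Real.pi) ^ d * h ^ d : ℝ) : ℂ) * inner ℂ (kleinGordon h x) x := by
    rw [← integral_complex_ofReal, ← h1]
    refine integral_congr_ae ?_
    filter_upwards [dft_kleinGordon hh x] with ξ hξ
    rw [hξ, ← smul_eq_mul (symbol h ξ : ℂ), inner_smul_left, inner_self_eq_norm_sq_to_K,
      Complex.conj_ofReal]
    push_cast
    rfl
  have h3 := congrArg Complex.re h2
  rwa [Complex.ofReal_re, Complex.re_ofReal_mul, mul_assoc] at h3

theorem integral_symbol_sq_mul_norm_sq_dft {h : ℝ} (hh : 0 < h) (x : L2 d) :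
    ∫ ξ, symbol h ξ ^ 2 * ‖dft h x ξ‖ ^ 2 ∂torusMeasure d h
      = (2 * Real.pi) ^ d * (h ^ d * ‖kleinGordon h x‖ ^ 2) := by
  rw [← integral_norm_sq_dft hh]
  refine integral_congr_ae ?_
  filter_upwards [dft_kleinGordon hh x] with ξ hξ
  rw [hξ, norm_mul, mul_pow, Complex.norm_real, Real.norm_of_nonneg (symbol_pos h ξ).le]

theorem sobolevNorm_two_sq {h : ℝ} (hh : 0 < h) (x : L2 d) :
    sobolevNorm 2 h x ^ 2 = h ^ d * ‖kleinGordon h x‖ ^ 2 := by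
  have hpi := Real.pi_pos
  have e : ∀ ξ : Fin d → ℝ, symbol h ξ ^ (2 : ℝ) = symbol h ξ ^ 2 := fun ξ => Real.rpow_two _
  simp only [sobolevNorm, e]
  rw [integral_symbol_sq_mul_norm_sq_dft hh, ← mul_assoc, one_div_mul_cancel (by positivity),
    one_mul, Real.sq_sqrt (by positivity)]

theorem sobolevNorm_one_sq {h : ℝ} (hh : 0 < h) (x : L2 d) :
    sobolevNorm 1 h x ^ 2 = h ^ d * gradSq h x := by
  have hpi := Real.pi_pos
  simp only [sobolevNorm, Real.rpow_one]
  rw [integral_symbol_mul_norm_sq_dft hh, ← mul_assoc, one_div_mul_cancel (by positivity),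
    one_mul, Real.sq_sqrt (mul_nonneg (by positivity) (gradSq_nonneg h x))]

theorem phaseNorm_sq {h : ℝ} (hh : 0 < h) (x y : L2 d) :
    phaseNorm h x y ^ 2 = h ^ d * (‖kleinGordon h x‖ ^ 2 + gradSq h y) := by
  rw [phaseNorm, Real.sq_sqrt (by positivity), sobolevNorm_two_sq hh, sobolevNorm_one_sq hh,
    mul_add]

/-! ### The discrete Gagliardo-Nirenberg inequality -/

/-- On the fundamental cell the symbol dominates a multiple of `1 + |ξ|^2`, uniformly in `h`. -/
theorem symbol_ge {h : ℝ} (hh : 0 < h) {ξ : Fin d → ℝ} (hξ : ξ ∈ cell d h) :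
    (1 + ‖ξ‖ ^ 2) / 4 ≤ symbol h ξ := by
  have hpi := Real.pi_pos
  have hj : ∀ j, (ξ j / 2) ^ 2 ≤ symbol h ξ - 1 := fun j => by
    have hx : |h * ξ j / 2| ≤ Real.pi / 2 := by
      have h1 := hξ j (Set.mem_univ j)
      have h2 : |ξ j| ≤ Real.pi / h := abs_le.2 ⟨h1.1, h1.2.le⟩
      rw [abs_div, abs_mul, abs_of_pos hh, abs_two]
      rw [le_div_iff₀ hh] at h2
      linarith
    have hs := pow_le_pow_left₀ (by positivity) (Real.mul_abs_le_abs_sin hx) 2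
    rw [mul_pow, sq_abs, sq_abs] at hs
    have hpi4 : (1 : ℝ) / 4 ≤ (2 / Real.pi) ^ 2 := by
      rw [div_pow, div_le_div_iff₀ (by norm_num) (by positivity)]
      nlinarith [Real.pi_le_four]
    have hsum : Real.sin (h * ξ j / 2) ^ 2 ≤ ∑ j : Fin d, Real.sin (h * ξ j / 2) ^ 2 :=
      Finset.single_le_sum (f := fun j => Real.sin (h * ξ j / 2) ^ 2)
        (fun _ _ => sq_nonneg _) (Finset.mem_univ j)
    calc (ξ j / 2) ^ 2 = 4 / h ^ 2 * (1 / 4 * (h * ξ j / 2) ^ 2) := by field_simp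
      _ ≤ 4 / h ^ 2 * ((2 / Real.pi) ^ 2 * (h * ξ j / 2) ^ 2) := by gcongr
      _ ≤ 4 / h ^ 2 * ∑ j : Fin d, Real.sin (h * ξ j / 2) ^ 2 := by
        gcongr
        exact hs.trans hsum
      _ = symbol h ξ - 1 := by rw [symbol]; ring
  have hn : ‖ξ‖ ≤ 2 * √(symbol h ξ - 1) := by
    refine (pi_norm_le_iff_of_nonneg (by positivity)).2 fun j => ?_
    have := Real.abs_le_sqrt (hj j)
    rw [abs_div, abs_two] at this
    rw [Real.norm_eq_abs]
    linarith
  have h1 := one_le_symbol h ξ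
  have h2 := pow_le_pow_left₀ (norm_nonneg ξ) hn 2
  rw [mul_pow, Real.sq_sqrt (by linarith)] at h2
  linarith

/-- The weight `m / a^2 + m^2 / b^2`, with `m` the symbol: it adapts to a function with `H^1` norm
at most `a` and `H^2` norm at most `b`. -/
def weight (h a b : ℝ) (ξ : Fin d → ℝ) : ℝ := symbol h ξ / a ^ 2 + symbol h ξ ^ 2 / b ^ 2

theorem weight_pos (h : ℝ) {a b : ℝ} (ha : 0 < a) (hb : 0 < b) (ξ : Fin d → ℝ) :
    0 < weight h a b ξ := by
  have := symbol_pos h ξ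
  unfold weight
  positivity

theorem continuous_weight (h a b : ℝ) : Continuous (weight h a b : (Fin d → ℝ) → ℝ) := by
  have := continuous_symbol (d := d) h
  unfold weight
  fun_prop

theorem norm_apply_le_integral_dft {h : ℝ} (hh : 0 < h) (x : L2 d) (n : Fin d → ℤ) :
    (2 * Real.pi) ^ d * ‖x n‖ ≤ ∫ ξ, ‖dft h x ξ‖ ∂torusMeasure d h := by
  have hpi := Real.pi_pos
  have e := congrArg norm (inner_characterLp_dft hh x n)
  rw [norm_mul, Complex.norm_real, Real.norm_of_nonneg (by positivity), inner_characterLp_left] at e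
  rw [← e]
  refine (norm_integral_le_integral_norm _).trans (le_of_eq ?_)
  simp only [norm_mul, norm_character, one_mul]

theorem isBounded_cell (d : ℕ) (h : ℝ) : Bornology.IsBounded (cell d h) :=
  Bornology.IsBounded.pi fun _ => Metric.isBounded_Ico _ _

/-- Integrability survives multiplication by a continuous function, which is bounded on the
relatively compact frequency cell. -/
theorem integrable_continuous_mul {h : ℝ} {φ : (Fin d → ℝ) → ℝ} (hφ : Continuous φ)
    {f : (Fin d → ℝ) → ℝ} (hf : Integrable f (torusMeasure d h)) :
    Integrable (fun ξ => φ ξ * f ξ) (torusMeasure d h) := by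
  obtain ⟨C, hC⟩ := (isBounded_cell d h).isCompact_closure.exists_bound_of_continuousOn
    hφ.continuousOn
  refine hf.bdd_mul (c := C) hφ.aestronglyMeasurable ?_
  refine (ae_restrict_iff' ?_).2 (ae_of_all _ fun ξ hξ => hC ξ (subset_closure hξ))
  exact MeasurableSet.univ_pi fun _ => measurableSet_Ico

theorem integrable_norm_sq_dft (h : ℝ) (x : LatticeFun d) :
    Integrable (fun ξ => ‖dft h x ξ‖ ^ 2) (torusMeasure d h) :=
  (memLp_two_iff_integrable_sq_norm (Lp.aestronglyMeasurable _)).1 (Lp.memLp _)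

/-- The values of a function are bounded by the integral of its Fourier transform; the
Cauchy-Schwarz inequality with weight `weight h a b` reduces the sup norm to the integral of the
inverse weight. -/
theorem norm_apply_le_of_integral_weight {h a b Q K : ℝ} (hh : 0 < h) (ha : 0 < a) (hb : 0 < b)
    (hQ : 0 < Q) (hK : 0 ≤ K) (x : L2 d) (h1 : h ^ d * gradSq h x ≤ a ^ 2)
    (h2 : h ^ d * ‖kleinGordon h x‖ ^ 2 ≤ b ^ 2)
    (hint : ∫ ξ, (weight h a b ξ)⁻¹ ∂torusMeasure d h ≤ K * Q ^ 2) (n : Fin d → ℤ) :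
    ‖x n‖ ≤ (1 + K) * Q := by
  have hpi := Real.pi_pos
  have hd : (1 : ℝ) ≤ (2 * Real.pi) ^ d := one_le_pow₀ (by linarith [Real.pi_gt_three])
  have i0 := integrable_norm_sq_dft h (x : LatticeFun d)
  have i1 := integrable_continuous_mul (continuous_symbol h) i0
  have i2 : Integrable (fun ξ => symbol h ξ ^ 2 * ‖dft h x ξ‖ ^ 2) (torusMeasure d h) :=
    integrable_continuous_mul ((continuous_symbol h).pow 2) i0
  have e1 := integral_symbol_mul_norm_sq_dft hh x
  have e2 := integral_symbol_sq_mul_norm_sq_dft hh x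
  have hw : ∫ ξ, weight h a b ξ * ‖dft h x ξ‖ ^ 2 ∂torusMeasure d h ≤ 2 * (2 * Real.pi) ^ d := by
    have e : ∀ ξ, weight h a b ξ * ‖dft h x ξ‖ ^ 2 = symbol h ξ * ‖dft h x ξ‖ ^ 2 / a ^ 2
        + symbol h ξ ^ 2 * ‖dft h x ξ‖ ^ 2 / b ^ 2 := fun ξ => by rw [weight]; ring
    simp only [e]
    rw [integral_add (i1.div_const _) (i2.div_const _), integral_div, integral_div, e1, e2]
    have b1 : (2 * Real.pi) ^ d * (h ^ d * gradSq h x) / a ^ 2 ≤ (2 * Real.pi) ^ d := by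
      rw [div_le_iff₀ (by positivity)]; gcongr
    have b2 : (2 * Real.pi) ^ d * (h ^ d * ‖kleinGordon h x‖ ^ 2) / b ^ 2
        ≤ (2 * Real.pi) ^ d := by
      rw [div_le_iff₀ (by positivity)]; gcongr
    linarith
  have iw := integrable_continuous_mul (continuous_weight h a b) i0
  have iv : Integrable (fun ξ => (weight h a b ξ)⁻¹) (torusMeasure d h) := by
    simpa using integrable_continuous_mul
      ((continuous_weight h a b).inv₀ fun ξ => (weight_pos h ha hb ξ).ne')
      (integrable_const (1 : ℝ))
  have hmain : ∫ ξ, ‖dft h x ξ‖ ∂torusMeasure d h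
      ≤ ∫ ξ, (Q / 2 * (weight h a b ξ * ‖dft h x ξ‖ ^ 2) + (2 * Q)⁻¹ * (weight h a b ξ)⁻¹)
        ∂torusMeasure d h := by
    refine integral_mono_of_nonneg (ae_of_all _ fun _ => norm_nonneg _)
      ((iw.const_mul _).add (iv.const_mul _)) (ae_of_all _ fun ξ => ?_)
    have hp := weight_pos h ha hb ξ
    set w := weight h a b ξ
    set z := ‖dft h x ξ‖
    -- the inequality of the means, balanced by `Q` so that both integrals are of order `Q`
    have : Q / 2 * (w * z ^ 2) + (2 * Q)⁻¹ * w⁻¹ - z = (Q * w * z - 1) ^ 2 / (2 * Q * w) := by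
      field_simp; ring
    have : 0 ≤ (Q * w * z - 1) ^ 2 / (2 * Q * w) := by positivity
    change z ≤ _
    linarith
  rw [integral_add (iw.const_mul _) (iv.const_mul _), integral_const_mul, integral_const_mul]
    at hmain
  have b1 : Q / 2 * ∫ ξ, weight h a b ξ * ‖dft h x ξ‖ ^ 2 ∂torusMeasure d h
      ≤ Q / 2 * (2 * (2 * Real.pi) ^ d) := by gcongr
  have b2 : (2 * Q)⁻¹ * ∫ ξ, (weight h a b ξ)⁻¹ ∂torusMeasure d h ≤ (2 * Q)⁻¹ * (K * Q ^ 2) := by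
    gcongr
  have b3 : (2 * Q)⁻¹ * (K * Q ^ 2) ≤ (2 * Real.pi) ^ d * (K * Q) := by
    have : (2 * Q)⁻¹ * (K * Q ^ 2) = K * Q / 2 := by field_simp
    rw [this]
    have : 0 ≤ K * Q := by positivity
    nlinarith
  have h3 := norm_apply_le_integral_dft hh x n
  refine le_of_mul_le_mul_left (h3.trans ?_) (by positivity : 0 < (2 * Real.pi) ^ d)
  linarith

/-- The subcritical case `d < 2 (1 + θ)`: by the inequality of the means the weight dominates
`m^{1+θ} / (a^{1-θ} b^θ)^2`, and `m^{-(1+θ)}` is integrable uniformly in `h`. -/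
theorem exists_integral_weight_le_of_lt {θ : ℝ} (hθ0 : 0 ≤ θ) (hθ1 : θ ≤ 1)
    (hd : (d : ℝ) < 2 * (1 + θ)) :
    ∃ K : ℝ, 0 ≤ K ∧ ∀ h a b : ℝ, 0 < h → 0 < a → 0 < b →
      ∫ ξ, (weight h a b ξ)⁻¹ ∂torusMeasure d h ≤ K * (a ^ (1 - θ) * b ^ θ) ^ 2 := by
  have hG : Integrable (fun ξ : Fin d → ℝ => (1 + ‖ξ‖) ^ (-(2 * (1 + θ)))) :=
    integrable_one_add_norm (by simpa using hd)
  refine ⟨8 ^ (1 + θ) * ∫ ξ : Fin d → ℝ, (1 + ‖ξ‖) ^ (-(2 * (1 + θ))),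
    mul_nonneg (by positivity) (integral_nonneg fun _ => by positivity), fun h a b hh ha hb => ?_⟩
  have hcell : MeasurableSet (cell d h) := MeasurableSet.univ_pi fun _ => measurableSet_Ico
  set Q := a ^ (1 - θ) * b ^ θ
  have hQ : 0 < Q := by positivity
  have hpt : ∀ ξ ∈ cell d h,
      (weight h a b ξ)⁻¹ ≤ Q ^ 2 * (8 ^ (1 + θ) * (1 + ‖ξ‖) ^ (-(2 * (1 + θ)))) := by
    intro ξ hξ
    have hm := symbol_pos h ξ
    have h8 : (1 + ‖ξ‖) ^ 2 / 8 ≤ symbol h ξ := by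
      refine le_trans ?_ (symbol_ge hh hξ)
      nlinarith [sq_nonneg (1 - ‖ξ‖)]
    have ham := Real.geom_mean_le_arith_mean2_weighted (w₁ := 1 - θ) (w₂ := θ)
      (p₁ := symbol h ξ / a ^ 2) (p₂ := symbol h ξ ^ 2 / b ^ 2) (by linarith) hθ0 (by positivity)
      (by positivity) (by ring)
    have hle : (1 - θ) * (symbol h ξ / a ^ 2) + θ * (symbol h ξ ^ 2 / b ^ 2) ≤ weight h a b ξ := by
      rw [weight]
      have p1 : 0 ≤ symbol h ξ / a ^ 2 := by positivity
      have p2 : 0 ≤ symbol h ξ ^ 2 / b ^ 2 := by positivity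
      nlinarith
    have hge : (symbol h ξ / a ^ 2) ^ (1 - θ) * (symbol h ξ ^ 2 / b ^ 2) ^ θ
        = symbol h ξ ^ (1 + θ) / Q ^ 2 := by
      rw [Real.div_rpow hm.le (by positivity), Real.div_rpow (by positivity) (by positivity),
        ← Real.rpow_natCast_mul hm.le, ← Real.rpow_natCast_mul ha.le,
        ← Real.rpow_natCast_mul hb.le, mul_pow, ← Real.rpow_mul_natCast ha.le,
        ← Real.rpow_mul_natCast hb.le, div_mul_div_comm, ← Real.rpow_add hm]
      push_cast
      ring_nf
    have hs : ((1 + ‖ξ‖) ^ 2 / 8) ^ (1 + θ) ≤ symbol h ξ ^ (1 + θ) :=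
      Real.rpow_le_rpow (by positivity) h8 (by linarith)
    rw [Real.div_rpow (by positivity) (by norm_num), ← Real.rpow_natCast_mul (by positivity)] at hs
    have hfin : (1 + ‖ξ‖) ^ (2 * (1 + θ)) / 8 ^ (1 + θ) / Q ^ 2 ≤ weight h a b ξ := by
      refine le_trans ?_ ((hge ▸ ham).trans hle)
      gcongr
      exact_mod_cast hs
    calc (weight h a b ξ)⁻¹ ≤ ((1 + ‖ξ‖) ^ (2 * (1 + θ)) / 8 ^ (1 + θ) / Q ^ 2)⁻¹ := by
          gcongr
      _ = _ := by
          rw [Real.rpow_neg (by positivity)]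
          field_simp
  have hI : Integrable
      (fun ξ : Fin d → ℝ => Q ^ 2 * (8 ^ (1 + θ) * (1 + ‖ξ‖) ^ (-(2 * (1 + θ))))) :=
    (hG.const_mul _).const_mul _
  calc ∫ ξ, (weight h a b ξ)⁻¹ ∂torusMeasure d h
      ≤ ∫ ξ, Q ^ 2 * (8 ^ (1 + θ) * (1 + ‖ξ‖) ^ (-(2 * (1 + θ)))) ∂torusMeasure d h :=
        integral_mono_of_nonneg (ae_of_all _ fun ξ => inv_nonneg.2 (weight_pos h ha hb ξ).le)
          hI.restrict ((ae_restrict_iff' hcell).2 (ae_of_all _ hpt))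
    _ ≤ ∫ ξ : Fin d → ℝ, Q ^ 2 * (8 ^ (1 + θ) * (1 + ‖ξ‖) ^ (-(2 * (1 + θ)))) :=
        setIntegral_le_integral hI (ae_of_all _ fun _ => by positivity)
    _ = _ := by
        rw [integral_const_mul, integral_const_mul]; ring

theorem integrableOn_and_integral_sq_div {a b : ℝ} (ha : 0 < a) (hb : 0 < b) :
    IntegrableOn (fun r : ℝ => a ^ 2 * (1 + (a / b * r) ^ 2)⁻¹) (Set.Ioi 0) ∧
      ∫ r in Set.Ioi (0 : ℝ), a ^ 2 * (1 + (a / b * r) ^ 2)⁻¹ = Real.pi / 2 * (a * b) := by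
  constructor
  · refine Integrable.integrableOn (Integrable.const_mul ?_ _)
    exact integrable_inv_one_add_sq.comp_mul_left' (by positivity)
  · rw [integral_const_mul,
      integral_comp_mul_left_Ioi (fun r : ℝ => (1 + r ^ 2)⁻¹) 0 (by positivity : 0 < a / b),
      mul_zero, integral_Ioi_inv_one_add_sq]
    simp
    field_simp

/-- The critical case `d = 3`, `θ = 1 / 2`: in polar coordinates for the sup norm, the inverse
weight is dominated by `16 a^2 / (1 + (a r / b)^2)`, whose integral over `r > 0` is `8 π a b`. -/
theorem exists_integral_weight_le_three :
    ∃ K : ℝ, 0 ≤ K ∧ ∀ h a b : ℝ, 0 < h → 0 < a → 0 < b →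
      ∫ ξ, (weight h a b ξ)⁻¹ ∂torusMeasure 3 h ≤ K * (a * b) := by
  set β := volume.real (Metric.ball (0 : Fin 3 → ℝ) 1)
  have hβ : 0 ≤ β := measureReal_nonneg
  have hpi := Real.pi_pos
  refine ⟨3 * (β * (16 * (Real.pi / 2))), by positivity, fun h a b hh ha hb => ?_⟩
  have hcell : MeasurableSet (cell 3 h) := MeasurableSet.univ_pi fun _ => measurableSet_Ico
  let G : ℝ → ℝ := fun r => ((1 + r ^ 2) / 4 / a ^ 2 + ((1 + r ^ 2) / 4) ^ 2 / b ^ 2)⁻¹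
  have hGc : Continuous G := by
    refine Continuous.inv₀ (by fun_prop) fun r => ?_
    positivity
  have hG0 : ∀ r, 0 ≤ G r := fun r => by positivity
  have hpt : ∀ ξ ∈ cell 3 h, (weight h a b ξ)⁻¹ ≤ G ‖ξ‖ := by
    intro ξ hξ
    have h4 := symbol_ge hh hξ
    have := symbol_pos h ξ
    exact inv_anti₀ (by positivity) (by unfold weight; gcongr)
  have hrad : ∀ r ∈ Set.Ioi (0 : ℝ),
      r ^ (3 - 1) * G r ≤ 16 * (a ^ 2 * (1 + (a / b * r) ^ 2)⁻¹) := by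
    intro r hr
    have hr : 0 < r := hr
    have e : 16 * (a ^ 2 * (1 + (a / b * r) ^ 2)⁻¹)
        = r ^ 2 * (r ^ 2 / 16 / a ^ 2 + (r ^ 2 / 4) ^ 2 / b ^ 2)⁻¹ := by
      field_simp; ring
    rw [e]
    change r ^ 2 * ((1 + r ^ 2) / 4 / a ^ 2 + ((1 + r ^ 2) / 4) ^ 2 / b ^ 2)⁻¹ ≤ _
    have hpos : 0 < r ^ 2 / 16 / a ^ 2 + (r ^ 2 / 4) ^ 2 / b ^ 2 := by positivity
    gcongr ?_ * ?_⁻¹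
    gcongr ?_ / a ^ 2 + (?_ / 4) ^ 2 / b ^ 2 <;> nlinarith [sq_nonneg r]
  obtain ⟨hi, he⟩ := integrableOn_and_integral_sq_div ha hb
  have hradI : IntegrableOn (fun r : ℝ => r ^ (3 - 1) * G r) (Set.Ioi 0) := by
    refine (hi.const_mul 16).mono' ?_ ?_
    · exact (((continuous_pow _).mul hGc).aestronglyMeasurable).restrict
    · refine (ae_restrict_iff' measurableSet_Ioi).2 (ae_of_all _ fun r hr => ?_)
      rw [Real.norm_of_nonneg (mul_nonneg (pow_nonneg (le_of_lt hr) _) (hG0 r))]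
      exact hrad r hr
  have hI : Integrable (fun ξ : Fin 3 → ℝ => G ‖ξ‖) := by
    rw [integrable_fun_norm_addHaar]
    simpa using hradI
  calc ∫ ξ, (weight h a b ξ)⁻¹ ∂torusMeasure 3 h
      ≤ ∫ ξ, G ‖ξ‖ ∂torusMeasure 3 h :=
        integral_mono_of_nonneg (ae_of_all _ fun ξ => inv_nonneg.2 (weight_pos h ha hb ξ).le)
          hI.restrict ((ae_restrict_iff' hcell).2 (ae_of_all _ hpt))
    _ ≤ ∫ ξ : Fin 3 → ℝ, G ‖ξ‖ := setIntegral_le_integral hI (ae_of_all _ fun _ => hG0 _)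
    _ = 3 * (β * ∫ r in Set.Ioi (0 : ℝ), r ^ (3 - 1) * G r) := by
        rw [integral_fun_norm_addHaar]
        simp [β]
    _ ≤ 3 * (β * ∫ r in Set.Ioi (0 : ℝ), 16 * (a ^ 2 * (1 + (a / b * r) ^ 2)⁻¹)) := by
        gcongr 3 * (β * ?_)
        exact setIntegral_mono_on hradI (hi.const_mul 16) measurableSet_Ioi hrad
    _ = _ := by
        rw [integral_const_mul, he]; ring

/-- Interpolation exponents `θ` for the inequality
`‖x‖_∞ ≤ C ‖x‖_{H^1}^{1 - θ} ‖x‖_{H^2}^θ`: all those above the scaling exponent `d / 2 - 1`, and the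
scaling exponent itself for `d = 3`. -/
def Admissible (d : ℕ) (θ : ℝ) : Prop :=
  0 ≤ θ ∧ θ ≤ 1 ∧ ((d : ℝ) < 2 * (1 + θ) ∨ (d = 3 ∧ θ = 1 / 2))

/-- The discrete Gagliardo-Nirenberg inequality, with a constant independent of `h`. -/
theorem Admissible.exists_norm_apply_le {θ : ℝ} (hθ : Admissible d θ) :
    ∃ K : ℝ, 0 < K ∧ ∀ h a b : ℝ, 0 < h → 0 < a → 0 < b → ∀ x : L2 d,
      h ^ d * gradSq h x ≤ a ^ 2 → h ^ d * ‖kleinGordon h x‖ ^ 2 ≤ b ^ 2 →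
      ∀ n, ‖x n‖ ≤ K * (a ^ (1 - θ) * b ^ θ) := by
  obtain ⟨h0, h1, hd⟩ := hθ
  have hw : ∃ K : ℝ, 0 ≤ K ∧ ∀ h a b : ℝ, 0 < h → 0 < a → 0 < b →
      ∫ ξ, (weight h a b ξ)⁻¹ ∂torusMeasure d h ≤ K * (a ^ (1 - θ) * b ^ θ) ^ 2 := by
    rcases hd with hd | ⟨rfl, rfl⟩
    · exact exists_integral_weight_le_of_lt h0 h1 hd
    · obtain ⟨K, hK, hle⟩ := exists_integral_weight_le_three
      refine ⟨K, hK, fun h a b hh ha hb => (hle h a b hh ha hb).trans_eq ?_⟩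
      rw [mul_pow, ← Real.rpow_mul_natCast ha.le, ← Real.rpow_mul_natCast hb.le]
      norm_num
  obtain ⟨K, hK, hle⟩ := hw
  refine ⟨1 + K, by positivity, fun h a b hh ha hb x hx1 hx2 n => ?_⟩
  exact norm_apply_le_of_integral_weight hh ha hb (by positivity) hK x hx1 hx2
    (hle h a b hh ha hb) n

/-! ### Solutions as differentiable curves in `L2 d` -/

/-- A curve whose coordinates have the coordinates of a continuous curve as derivatives is
differentiable in norm, since it is the integral of its derivative. -/
theorem hasDerivWithinAt_of_apply {T : ℝ} (hT : 0 ≤ T) {U V : ℝ → L2 d}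
    (hV : ContinuousOn V (Set.Icc 0 T))
    (hUV : ∀ t ∈ Set.Icc 0 T, ∀ n,
      HasDerivWithinAt (fun τ => U τ n) (V t n) (Set.Icc 0 T) t)
    {t : ℝ} (ht : t ∈ Set.Icc 0 T) : HasDerivWithinAt U (V t) (Set.Icc 0 T) t := by
  let V' : ℝ → L2 d := Set.IccExtend hT ((Set.Icc 0 T).domRestrict V)
  have hV' : Continuous V' := (continuousOn_iff_continuous_domRestrict.1 hV).Icc_extend'
  have hVV' : ∀ s ∈ Set.Icc 0 T, V' s = V s := fun s hs => Set.IccExtend_of_mem hT _ hs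
  let W : ℝ → L2 d := fun s => U 0 + ∫ τ in (0 : ℝ)..s, V' τ
  have hW : ∀ s, HasDerivAt W (V' s) s := fun s =>
    ((hV'.integral_hasStrictDerivAt 0 s).hasDerivAt).const_add _
  have hWU : ∀ s ∈ Set.Icc 0 T, U s = W s := by
    intro s hs
    ext n
    have hWn : ∀ τ, HasDerivAt (fun τ => W τ n) (V' τ n) τ := fun τ =>
      (((lp.evalCLM ℂ (fun _ : Fin d → ℤ => ℂ) 2 n).restrictScalars ℝ).hasFDerivAt).comp_hasDerivAt
        τ (hW τ)
    have hconst := (convex_Icc (0 : ℝ) T).norm_image_sub_le_of_norm_hasDerivWithin_le (C := 0)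
      (f := fun τ => U τ n - W τ n) (f' := fun τ => V τ n - V' τ n)
      (fun τ hτ => (hUV τ hτ n).sub (hWn τ).hasDerivWithinAt)
      (fun τ hτ => by rw [hVV' τ hτ, sub_self, norm_zero]) (Set.left_mem_Icc.2 hT) hs
    rw [zero_mul, norm_le_zero_iff] at hconst
    have h0 : W 0 = U 0 := by simp [W]
    rw [h0, sub_self, sub_zero] at hconst
    exact sub_eq_zero.1 hconst
  rw [← hVV' t ht]
  exact (hW t).hasDerivWithinAt.congr hWU (hWU t ht)

/-- A solution of the discrete Klein-Gordon equation, with velocity `V`, as a differentiable curve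
in the phase space `L2 d × L2 d`. -/
structure IsStrongSolution (p h T : ℝ) (U V : ℝ → L2 d) : Prop where
  deriv_fst : ∀ t ∈ Set.Icc 0 T, HasDerivWithinAt U (V t) (Set.Icc 0 T) t
  deriv_snd : ∀ t ∈ Set.Icc 0 T,
    HasDerivWithinAt V (-kleinGordon h (U t) - powerL2 p (U t)) (Set.Icc 0 T) t

open Classical in
/-- The element of `L2 d` with values `g n`, or `0` if `g` is not square summable. -/
def toL2 (g : LatticeFun d) : L2 d := if hg : Memℓp g 2 then ⟨g, hg⟩ else 0

theorem coe_toL2 {g : LatticeFun d} (hg : Memℓp g 2) : (toL2 g : LatticeFun d) = g := by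
  rw [toL2, dif_pos hg]

theorem norm_sq_le_sobolevNorm_two_sq {h : ℝ} (hh : 0 < h) (x : L2 d) :
    h ^ d * ‖x‖ ^ 2 ≤ sobolevNorm 2 h x ^ 2 := by
  rw [sobolevNorm_two_sq hh]
  have := norm_le_norm_kleinGordon h x
  gcongr

theorem norm_sq_le_sobolevNorm_one_sq {h : ℝ} (hh : 0 < h) (x : L2 d) :
    h ^ d * ‖x‖ ^ 2 ≤ sobolevNorm 1 h x ^ 2 := by
  rw [sobolevNorm_one_sq hh]
  have := norm_sq_le_gradSq h x
  gcongr

theorem ContinuousInSobolev.continuousOn_toL2 {s h T : ℝ} (hh : 0 < h)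
    (hs : ∀ x : L2 d, h ^ d * ‖x‖ ^ 2 ≤ sobolevNorm s h x ^ 2) {u : ℝ → LatticeFun d}
    (hu : ContinuousInSobolev s h T u) : ContinuousOn (fun t => toL2 (u t)) (Set.Icc 0 T) := by
  intro t ht
  rw [ContinuousWithinAt, tendsto_iff_norm_sub_tendsto_zero]
  have hlim := ((hu.2 t ht).const_mul (√(h ^ d))⁻¹)
  rw [mul_zero] at hlim
  refine squeeze_zero' (Eventually.of_forall fun τ => norm_nonneg _) ?_ hlim
  filter_upwards [self_mem_nhdsWithin] with τ hτ
  have hpos : 0 < h ^ d := by positivity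
  have e : ((toL2 (u τ) - toL2 (u t) : L2 d) : LatticeFun d) = u τ - u t := by
    rw [lp.coeFn_sub, coe_toL2 (hu.1 τ hτ).1, coe_toL2 (hu.1 t ht).1]
  have h1 := hs (toL2 (u τ) - toL2 (u t))
  rw [e] at h1
  rw [inv_mul_eq_div, le_div_iff₀ (Real.sqrt_pos.2 hpos)]
  refine le_of_sq_le_sq ?_ (Real.sqrt_nonneg _)
  rw [mul_pow, Real.sq_sqrt hpos.le, mul_comm]
  exact h1

theorem IsSolution.isStrongSolution {p h T : ℝ} (hp : 1 < p) (hh : 0 < h) (hT : 0 ≤ T)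
    {u₀ u₁ : LatticeFun d} {u v : ℝ → LatticeFun d} (hs : IsSolution p h T u₀ u₁ u v) :
    IsStrongSolution p h T (fun t => toL2 (u t)) (fun t => toL2 (v t)) := by
  have hcu := hs.continuous_fst.continuousOn_toL2 hh (norm_sq_le_sobolevNorm_two_sq hh)
  have hcv := hs.continuous_snd.continuousOn_toL2 hh (norm_sq_le_sobolevNorm_one_sq hh)
  have eu : ∀ t ∈ Set.Icc 0 T, (toL2 (u t) : LatticeFun d) = u t := fun t ht =>
    coe_toL2 (hs.continuous_fst.1 t ht).1
  have ev : ∀ t ∈ Set.Icc 0 T, (toL2 (v t) : LatticeFun d) = v t := fun t ht =>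
    coe_toL2 (hs.continuous_snd.1 t ht).1
  refine ⟨fun t ht => hasDerivWithinAt_of_apply hT hcv (fun s hs' n => ?_) ht,
    fun t ht => hasDerivWithinAt_of_apply hT (V := fun s => -kleinGordon h (toL2 (u s))
      - powerL2 p (toL2 (u s))) ?_ (fun s hs' n => ?_) ht⟩
  · rw [ev s hs']
    exact (hs.deriv_fst s hs' n).congr (fun τ hτ => by rw [eu τ hτ]) (by rw [eu s hs'])
  · exact ((kleinGordon h).continuous.comp_continuousOn hcu).neg.sub
      ((continuous_powerL2 hp).comp_continuousOn hcu)
  · have e : (-kleinGordon h (toL2 (u s)) - powerL2 p (toL2 (u s)) : L2 d) n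
        = laplacian h (u s) n - u s n - ((‖u s n‖ ^ (p - 1) : ℝ) : ℂ) * u s n := by
      rw [lp.coeFn_sub, Pi.sub_apply, lp.coeFn_neg, Pi.neg_apply, kleinGordon_apply,
        powerL2_apply hp, eu s hs', power]
      ring
    rw [e]
    exact (hs.deriv_snd s hs' n).congr (fun τ hτ => by rw [ev τ hτ]) (by rw [ev s hs'])

/-! ### Conservation of energy -/

theorem hasDerivWithinAt_re_inner {f g : ℝ → L2 d} {f' g' : L2 d} {s : Set ℝ} {t : ℝ}
    (hf : HasDerivWithinAt f f' s t) (hg : HasDerivWithinAt g g' s t) :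
    HasDerivWithinAt (fun τ => (inner ℂ (f τ) (g τ)).re)
      ((inner ℂ (f t) g').re + (inner ℂ f' (g t)).re) s t := by
  have := Complex.reCLM.hasFDerivAt.comp_hasDerivWithinAt t (hf.inner ℂ hg)
  rw [map_add] at this
  exact this

theorem hasDerivWithinAt_kleinGordon (h : ℝ) {f : ℝ → L2 d} {f' : L2 d} {s : Set ℝ} {t : ℝ}
    (hf : HasDerivWithinAt f f' s t) :
    HasDerivWithinAt (fun τ => kleinGordon h (f τ)) (kleinGordon h f') s t :=
  ((kleinGordon h).restrictScalars ℝ).hasFDerivAt.comp_hasDerivWithinAt t hf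

theorem re_inner_comm (x y : L2 d) : (inner ℂ x y).re = (inner ℂ y x).re := by
  rw [← inner_conj_symm, Complex.conj_re]

theorem hasDerivWithinAt_norm_sq {f : ℝ → L2 d} {f' : L2 d} {s : Set ℝ} {t : ℝ}
    (hf : HasDerivWithinAt f f' s t) :
    HasDerivWithinAt (fun τ => ‖f τ‖ ^ 2) (2 * (inner ℂ (f t) f').re) s t := by
  have e : ∀ x : L2 d, ‖x‖ ^ 2 = (inner ℂ x x).re := fun x => by
    rw [inner_self_eq_norm_sq_to_K]; norm_cast
  simp only [e]
  refine (hasDerivWithinAt_re_inner hf hf).congr_deriv ?_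
  rw [re_inner_comm f']
  ring

theorem hasDerivWithinAt_gradSq (h : ℝ) {f : ℝ → L2 d} {f' : L2 d} {s : Set ℝ} {t : ℝ}
    (hf : HasDerivWithinAt f f' s t) :
    HasDerivWithinAt (fun τ => gradSq h (f τ)) (2 * (inner ℂ (kleinGordon h (f t)) f').re) s t := by
  refine (hasDerivWithinAt_re_inner (hasDerivWithinAt_kleinGordon h hf) hf).congr_deriv ?_
  rw [inner_kleinGordon_comm h f', re_inner_comm f']
  ring

theorem hasDerivWithinAt_potentialSum {p : ℝ} (hp : 1 < p) {f : ℝ → L2 d} {f' : L2 d}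
    {s : Set ℝ} {t : ℝ} (hf : HasDerivWithinAt f f' s t) :
    HasDerivWithinAt (fun τ => potentialSum p (f τ)) (inner ℂ (powerL2 p (f t)) f').re s t := by
  -- the linear functional given by the gradient of the potential energy at `f t`
  let ℓ : L2 d →L[ℝ] ℝ :=
    Complex.reCLM.comp ((innerSL ℂ (powerL2 p (f t))).restrictScalars ℝ)
  have hfd : HasFDerivAt (potentialSum p) ℓ (f t) := by
    refine HasFDerivAt.of_isLittleO ?_
    have hO : (fun y : L2 d => potentialSum p y - potentialSum p (f t) - ℓ (y - f t))
        =O[𝓝 (f t)] fun y => ‖y - f t‖ ^ 2 := by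
      refine Asymptotics.IsBigO.of_bound (p * (‖f t‖ + 1) ^ (p - 1)) ?_
      filter_upwards [Metric.ball_mem_nhds (f t) one_pos] with y hy
      rw [mem_ball_iff_norm] at hy
      rw [Real.norm_eq_abs, Real.norm_of_nonneg (sq_nonneg ‖y - f t‖)]
      exact abs_potentialSum_sub_le hp (by linarith) (by linarith [norm_sub_norm_le y (f t)])
    refine hO.trans_isLittleO ?_
    have h1 : (fun y : L2 d => ‖y - f t‖) =o[𝓝 (f t)] fun _ => (1 : ℝ) := by
      rw [Asymptotics.isLittleO_one_iff]
      exact tendsto_iff_norm_sub_tendsto_zero.1 tendsto_id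
    have h2 := h1.mul_isBigO (Asymptotics.isBigO_refl (fun y : L2 d => ‖y - f t‖) (𝓝 (f t)))
    simpa [sq] using h2
  exact hfd.comp_hasDerivWithinAt t hf

/-- The energy of the solution, up to the factor `h ^ d`. -/
def energy (p h : ℝ) (x y : L2 d) : ℝ :=
  ‖y‖ ^ 2 / 2 + gradSq h x / 2 + potentialSum p x

theorem IsStrongSolution.energy_eq {p h T : ℝ} (hp : 1 < p) {U V : ℝ → L2 d}
    (hs : IsStrongSolution p h T U V) {t : ℝ} (ht : t ∈ Set.Icc 0 T) :
    energy p h (U t) (V t) = energy p h (U 0) (V 0) := by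
  have hd : ∀ τ ∈ Set.Icc 0 T,
      HasDerivWithinAt (fun τ => energy p h (U τ) (V τ)) 0 (Set.Icc 0 T) τ := fun τ hτ => by
    have hU := hs.deriv_fst τ hτ
    have hV := hs.deriv_snd τ hτ
    refine ((((hasDerivWithinAt_norm_sq hV).div_const 2).add
      ((hasDerivWithinAt_gradSq h hU).div_const 2)).add
        (hasDerivWithinAt_potentialSum hp hU)).congr_deriv ?_
    rw [inner_sub_right, inner_neg_right, Complex.sub_re, Complex.neg_re,
      re_inner_comm (V τ) (kleinGordon h (U τ)), re_inner_comm (V τ) (powerL2 p (U τ))]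
    ring
  have hc := (convex_Icc (0 : ℝ) T).norm_image_sub_le_of_norm_hasDerivWithin_le (C := 0) hd
    (fun _ _ => by simp) (Set.left_mem_Icc.2 (ht.1.trans ht.2)) ht
  rw [zero_mul, norm_le_zero_iff] at hc
  exact sub_eq_zero.1 hc

/-! ### Growth of the `H^2 × H^1` norm -/

/-- The square of the `H^2 × H^1` norm, up to the factor `h ^ d`. -/
def phaseSq (h : ℝ) (x y : L2 d) : ℝ := ‖kleinGordon h x‖ ^ 2 + gradSq h y

theorem phaseSq_nonneg (h : ℝ) (x y : L2 d) : 0 ≤ phaseSq h x y :=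
  add_nonneg (sq_nonneg _) (gradSq_nonneg h y)

theorem IsStrongSolution.hasDerivWithinAt_phaseSq {p h T : ℝ} {U V : ℝ → L2 d}
    (hs : IsStrongSolution p h T U V) {t : ℝ} (ht : t ∈ Set.Icc 0 T) :
    HasDerivWithinAt (fun τ => phaseSq h (U τ) (V τ))
      (-(2 * (inner ℂ (kleinGordon h (V t)) (powerL2 p (U t))).re)) (Set.Icc 0 T) t := by
  have hU := hs.deriv_fst t ht
  have hV := hs.deriv_snd t ht
  refine ((hasDerivWithinAt_norm_sq (hasDerivWithinAt_kleinGordon h hU)).add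
    (hasDerivWithinAt_gradSq h hV)).congr_deriv ?_
  rw [inner_sub_right, inner_neg_right, Complex.sub_re, Complex.neg_re,
    re_inner_comm (kleinGordon h (V t)) (kleinGordon h (U t))]
  ring

/-- A Gronwall type inequality: if `z ≥ 1` and `z' ≤ C z^{(1+α)/2}` with `α < 1` then
`z^{(1-α)/2}` grows at most linearly. -/
theorem rpow_le_add_of_deriv_le {T C α : ℝ} (hα0 : 0 ≤ α) (hα1 : α < 1) (hC : 0 ≤ C)
    {z z' : ℝ → ℝ} (hz1 : ∀ t ∈ Set.Icc 0 T, 1 ≤ z t)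
    (hz : ∀ t ∈ Set.Icc 0 T, HasDerivWithinAt z (z' t) (Set.Icc 0 T) t)
    (hle : ∀ t ∈ Set.Icc 0 T, z' t ≤ C * z t ^ ((1 + α) / 2)) {t : ℝ} (ht : t ∈ Set.Icc 0 T) :
    z t ^ ((1 - α) / 2) ≤ z 0 ^ ((1 - α) / 2) + C * t := by
  have hw : ∀ τ ∈ Set.Icc 0 T, HasDerivWithinAt (fun τ => z τ ^ ((1 - α) / 2) - C * τ)
      (z' τ * ((1 - α) / 2) * z τ ^ ((1 - α) / 2 - 1) - C * 1) (Set.Icc 0 T) τ := fun τ hτ =>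
    ((hz τ hτ).rpow_const (Or.inl (by linarith [hz1 τ hτ]))).sub
      ((hasDerivWithinAt_id τ _).const_mul C)
  have hanti := antitoneOn_of_hasDerivWithinAt_nonpos (convex_Icc (0 : ℝ) T)
    (fun τ hτ => (hw τ hτ).continuousWithinAt)
    (fun τ hτ => (hw τ (interior_subset hτ)).mono interior_subset) fun τ hτ => by
      have hτ' := interior_subset hτ
      have hpos : 0 < z τ := by linarith [hz1 τ hτ']
      have hmul : z τ ^ ((1 + α) / 2) * z τ ^ ((1 - α) / 2 - 1) = 1 := by
        rw [← Real.rpow_add hpos]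
        ring_nf
        exact Real.rpow_zero _
      have h1 : z' τ * z τ ^ ((1 - α) / 2 - 1) ≤ C := by
        calc z' τ * z τ ^ ((1 - α) / 2 - 1)
            ≤ C * z τ ^ ((1 + α) / 2) * z τ ^ ((1 - α) / 2 - 1) := by
              gcongr
              exact hle τ hτ'
          _ = C := by rw [mul_assoc, hmul, mul_one]
      have h2 : (1 - α) / 2 * (z' τ * z τ ^ ((1 - α) / 2 - 1)) ≤ (1 - α) / 2 * C := by
        have : 0 ≤ (1 - α) / 2 := by linarith
        gcongr
      nlinarith
  have := hanti (Set.left_mem_Icc.2 (ht.1.trans ht.2)) ht ht.1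
  simp only [mul_zero, sub_zero] at this
  linarith

/-- The `H^1` norm of a solution stays bounded, by conservation of energy. -/
theorem IsStrongSolution.gradSq_le {p h T r S : ℝ} (hp : 1 < p) (hh : 0 < h) {U V : ℝ → L2 d}
    (hs : IsStrongSolution p h T U V) (hr : h ^ d * phaseSq h (U 0) (V 0) ≤ r ^ 2)
    (hS : ∀ n, ‖U 0 n‖ ≤ S) {t : ℝ} (ht : t ∈ Set.Icc 0 T) :
    h ^ d * gradSq h (U t) ≤ 2 * (1 + S ^ (p - 1)) * r ^ 2 := by
  have hS0 : 0 ≤ S ^ (p - 1) := Real.rpow_nonneg ((norm_nonneg _).trans (hS 0)) _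
  have he := hs.energy_eq hp ht
  have hpot := potentialSum_nonneg hp (U t)
  have hpot0 := potentialSum_le hp hS
  have hL := norm_le_norm_kleinGordon h (U 0)
  have hg := gradSq_le_norm_kleinGordon_sq h (U 0)
  have hL2 : ‖U 0‖ ^ 2 ≤ ‖kleinGordon h (U 0)‖ ^ 2 := by gcongr
  have hV0 := norm_sq_le_gradSq h (V 0)
  have hVt : 0 ≤ ‖V t‖ ^ 2 := by positivity
  have hQ : S ^ (p - 1) * ‖U 0‖ ^ 2 ≤ S ^ (p - 1) * phaseSq h (U 0) (V 0) := by
    have := gradSq_nonneg h (V 0)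
    gcongr
    rw [phaseSq]
    linarith
  have hphase := phaseSq_nonneg h (U 0) (V 0)
  have hmain : gradSq h (U t) ≤ 2 * (1 + S ^ (p - 1)) * phaseSq h (U 0) (V 0) := by
    rw [energy, energy] at he
    have : phaseSq h (U 0) (V 0) = ‖kleinGordon h (U 0)‖ ^ 2 + gradSq h (V 0) := rfl
    nlinarith
  calc h ^ d * gradSq h (U t) ≤ h ^ d * (2 * (1 + S ^ (p - 1)) * phaseSq h (U 0) (V 0)) := by
        gcongr
    _ = 2 * (1 + S ^ (p - 1)) * (h ^ d * phaseSq h (U 0) (V 0)) := by ring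
    _ ≤ _ := by gcongr

/-- The growth of the `H^2 × H^1` norm, in terms of an exponent `α ≥ θ (p - 1)` with `θ`
admissible for the Gagliardo-Nirenberg inequality. -/
theorem exists_phaseSq_le {p θ α : ℝ} (hp : 1 < p) (hθ : Admissible d θ) (hθα : θ * (p - 1) ≤ α)
    (hα1 : α < 1) {r : ℝ} (hr : 0 < r) :
    ∃ C : ℝ, 0 ≤ C ∧ ∀ h T : ℝ, 0 < h → ∀ U V : ℝ → L2 d, IsStrongSolution p h T U V →
      h ^ d * phaseSq h (U 0) (V 0) ≤ r ^ 2 → ∀ t ∈ Set.Icc 0 T,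
      √(h ^ d * phaseSq h (U t) (V t)) ≤ C * (1 + T) ^ (1 / (1 - α)) := by
  obtain ⟨K, hK, hGN⟩ := hθ.exists_norm_apply_le
  have hα0 : 0 ≤ α := (mul_nonneg hθ.1 (by linarith)).trans hθα
  -- `S` bounds the initial sup norm, `a` the `H^1` norm, and `C₁` is the constant in the
  -- differential inequality for `1 + h ^ d * phaseSq`
  obtain ⟨S, hSdef⟩ : ∃ S, S = K * (r ^ (1 - θ) * r ^ θ) := ⟨_, rfl⟩
  have hS : 0 < S := by rw [hSdef]; positivity
  obtain ⟨a, ha, ha2⟩ : ∃ a : ℝ, 0 < a ∧ a ^ 2 = 2 * (1 + S ^ (p - 1)) * r ^ 2 :=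
    ⟨√(2 * (1 + S ^ (p - 1)) * r ^ 2), by positivity, Real.sq_sqrt (by positivity)⟩
  obtain ⟨C₁, hC₁⟩ : ∃ C₁, C₁ = 2 * (p * (K * a ^ (1 - θ)) ^ (p - 1) * a) := ⟨_, rfl⟩
  have hC₁0 : 0 ≤ C₁ := by rw [hC₁]; positivity
  refine ⟨((1 + r ^ 2) ^ ((1 - α) / 2) + C₁) ^ (1 / (1 - α)), by positivity,
    fun h T hh U V hs h0 t ht => ?_⟩
  have hhd : 0 < h ^ d := by positivity
  have hT : 0 ≤ T := ht.1.trans ht.2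
  have hph : ∀ x y : L2 d, 0 ≤ h ^ d * phaseSq h x y := fun x y =>
    mul_nonneg hhd.le (phaseSq_nonneg h x y)
  have hfst : ∀ x y : L2 d, h ^ d * ‖kleinGordon h x‖ ^ 2 ≤ h ^ d * phaseSq h x y := fun x y => by
    have := gradSq_nonneg h y
    rw [phaseSq]; gcongr; linarith
  have hS0 : ∀ n, ‖U 0 n‖ ≤ S := fun n => by
    rw [hSdef]
    refine hGN h r r hh hr hr (U 0) ?_ ((hfst _ _).trans h0) n
    exact (mul_le_mul_of_nonneg_left (gradSq_le_norm_kleinGordon_sq h _) hhd.le).trans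
      ((hfst _ _).trans h0)
  have hH1 : ∀ τ ∈ Set.Icc 0 T, h ^ d * gradSq h (U τ) ≤ a ^ 2 := fun τ hτ =>
    (hs.gradSq_le hp hh h0 hS0 hτ).trans_eq ha2.symm
  let z : ℝ → ℝ := fun τ => 1 + h ^ d * phaseSq h (U τ) (V τ)
  have hz1 : ∀ τ ∈ Set.Icc 0 T, 1 ≤ z τ := fun τ _ => le_add_of_nonneg_right (hph _ _)
  have hz : ∀ τ ∈ Set.Icc 0 T, HasDerivWithinAt z (h ^ d *
      -(2 * (inner ℂ (kleinGordon h (V τ)) (powerL2 p (U τ))).re)) (Set.Icc 0 T) τ := fun τ hτ =>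
    ((hs.hasDerivWithinAt_phaseSq hτ).const_mul _).const_add _
  have hle : ∀ τ ∈ Set.Icc 0 T, h ^ d *
      -(2 * (inner ℂ (kleinGordon h (V τ)) (powerL2 p (U τ))).re)
      ≤ C₁ * z τ ^ ((1 + α) / 2) := by
    intro τ hτ
    have hzp : 0 < z τ := one_pos.trans_le (hz1 τ hτ)
    have hb1 : 1 ≤ √(z τ) := Real.one_le_sqrt.2 (hz1 τ hτ)
    have hb0 : 0 < √(z τ) := by linarith
    have hsup := hGN h a (√(z τ)) hh ha hb0 (U τ) (hH1 τ hτ) (by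
      rw [Real.sq_sqrt hzp.le]
      exact (hfst _ _).trans (le_add_of_nonneg_left zero_le_one))
    have hN := gradSq_powerL2_le h hp hsup
    have hrp : (K * (a ^ (1 - θ) * √(z τ) ^ θ)) ^ (p - 1)
        ≤ (K * a ^ (1 - θ)) ^ (p - 1) * √(z τ) ^ α := by
      rw [← mul_assoc, Real.mul_rpow (by positivity) (by positivity), ← Real.rpow_mul hb0.le]
      gcongr
    have hsqN : √(h ^ d * gradSq h (powerL2 p (U τ)))
        ≤ p * ((K * a ^ (1 - θ)) ^ (p - 1) * √(z τ) ^ α) * a := by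
      refine Real.sqrt_le_iff.2 ⟨by positivity, ?_⟩
      calc h ^ d * gradSq h (powerL2 p (U τ))
          ≤ h ^ d * ((p * (K * (a ^ (1 - θ) * √(z τ) ^ θ)) ^ (p - 1)) ^ 2 * gradSq h (U τ)) := by
            gcongr
        _ = (p * (K * (a ^ (1 - θ) * √(z τ) ^ θ)) ^ (p - 1)) ^ 2 * (h ^ d * gradSq h (U τ)) := by
            ring
        _ ≤ (p * ((K * a ^ (1 - θ)) ^ (p - 1) * √(z τ) ^ α)) ^ 2 * a ^ 2 := by
            have hg : 0 ≤ h ^ d * gradSq h (U τ) := mul_nonneg hhd.le (gradSq_nonneg h _)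
            gcongr ?_ ^ 2 * ?_
            · gcongr
            · exact hH1 τ hτ
        _ = _ := by ring
    have hsqV : √(h ^ d * gradSq h (V τ)) ≤ √(z τ) := by
      refine Real.sqrt_le_sqrt ?_
      have h1 : gradSq h (V τ) ≤ phaseSq h (U τ) (V τ) := by
        rw [phaseSq]; exact le_add_of_nonneg_left (sq_nonneg _)
      have h2 := mul_le_mul_of_nonneg_left h1 hhd.le
      change _ ≤ 1 + _
      linarith
    have hcs := abs_re_inner_kleinGordon_le h (V τ) (powerL2 p (U τ))
    have hpow : z τ ^ ((1 + α) / 2) = √(z τ) * √(z τ) ^ α := by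
      rw [Real.sqrt_eq_rpow, ← Real.rpow_mul hzp.le, ← Real.rpow_add hzp]
      congr 1
      ring
    calc h ^ d * -(2 * (inner ℂ (kleinGordon h (V τ)) (powerL2 p (U τ))).re)
        ≤ h ^ d * (2 * (√(gradSq h (V τ)) * √(gradSq h (powerL2 p (U τ))))) := by
          gcongr
          linarith [neg_abs_le (inner ℂ (kleinGordon h (V τ)) (powerL2 p (U τ))).re]
      _ = 2 * (√(h ^ d * gradSq h (V τ)) * √(h ^ d * gradSq h (powerL2 p (U τ)))) := by
          rw [Real.sqrt_mul hhd.le, Real.sqrt_mul hhd.le, mul_mul_mul_comm,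
            Real.mul_self_sqrt hhd.le]
          ring
      _ ≤ 2 * (√(z τ) * (p * ((K * a ^ (1 - θ)) ^ (p - 1) * √(z τ) ^ α) * a)) := by
          gcongr
      _ = C₁ * z τ ^ ((1 + α) / 2) := by rw [hpow, hC₁]; ring
  have hgrow := rpow_le_add_of_deriv_le hα0 hα1 hC₁0 hz1 hz hle ht
  have hz0 : z 0 ^ ((1 - α) / 2) ≤ (1 + r ^ 2) ^ ((1 - α) / 2) := by
    have h1 := hz1 0 (Set.left_mem_Icc.2 hT)
    refine Real.rpow_le_rpow (by linarith) ?_ (by linarith)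
    change 1 + _ ≤ _
    linarith
  have hM : 0 ≤ (1 + r ^ 2) ^ ((1 - α) / 2) := by positivity
  have hlin : z t ^ ((1 - α) / 2) ≤ ((1 + r ^ 2) ^ ((1 - α) / 2) + C₁) * (1 + T) := by
    nlinarith [ht.2, mul_le_mul_of_nonneg_left ht.2 hC₁0, mul_nonneg hM hT]
  have hzt : 0 ≤ z t := zero_le_one.trans (hz1 t ht)
  have hα : 0 < 1 - α := by linarith
  calc √(h ^ d * phaseSq h (U t) (V t)) ≤ √(z t) :=
        Real.sqrt_le_sqrt (le_add_of_nonneg_left zero_le_one)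
    _ = (z t ^ ((1 - α) / 2)) ^ (1 / (1 - α)) := by
        rw [← Real.rpow_mul hzt, Real.sqrt_eq_rpow]
        congr 1
        field_simp
    _ ≤ (((1 + r ^ 2) ^ ((1 - α) / 2) + C₁) * (1 + T)) ^ (1 / (1 - α)) :=
        Real.rpow_le_rpow (by positivity) hlin (by positivity)
    _ = _ := Real.mul_rpow (by positivity) (by positivity)

end DNLKG
end

theorem proposition2 (d : ℕ) (hd1 : 1 ≤ d) (hd3 : d ≤ 3)
    (p : ℝ) (hp : 1 < p) (hp3 : d = 3 → p < 3)
    (ε : ℝ) (hε0 : 0 < ε) (hε1 : ε < 1) (R : ℝ) :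
    ∃ C : ℝ, ∀ h : ℝ, 0 < h →
      ∀ u₀ u₁ : DNLKG.LatticeFun d,
        DNLKG.MemSobolev 2 h u₀ → DNLKG.MemSobolev 1 h u₁ →
        DNLKG.phaseNorm h u₀ u₁ ≤ R →
        ∀ T : ℝ, 0 < T → ∀ u v : ℝ → DNLKG.LatticeFun d,
          DNLKG.IsSolution p h T u₀ u₁ u v →
          ∀ t ∈ Set.Icc 0 T,
            DNLKG.phaseNorm h (u t) (v t) ≤ C * (1 + T) ^ DNLKG.growthExponent d p ε := by
  obtain ⟨θ, α, hθ, hθα, hα1, hexp⟩ : ∃ θ α : ℝ, DNLKG.Admissible d θ ∧ θ * (p - 1) ≤ α ∧ α < 1 ∧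
      DNLKG.growthExponent d p ε = 1 / (1 - α) := by
    obtain rfl | rfl | rfl : d = 1 ∨ d = 2 ∨ d = 3 := by omega
    · exact ⟨0, 0, ⟨le_rfl, zero_le_one, Or.inl (by norm_num)⟩, by simp, one_pos,
        by simp [DNLKG.growthExponent]⟩
    · have hp1 : 0 < p - 1 := by linarith
      -- `H^1` just fails to embed in the sup norm: any `θ > 0` is admissible, and it is chosen so
      -- that `θ (p - 1) ≤ ε`
      refine ⟨min 1 (ε / (p - 1)), ε, ⟨by positivity, min_le_left _ _, Or.inl ?_⟩, ?_, hε1,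
        by simp [DNLKG.growthExponent]⟩
      · have : 0 < min 1 (ε / (p - 1)) := by positivity
        push_cast
        linarith
      · exact (le_div_iff₀ hp1).1 (min_le_right _ _)
    · have hp3' := hp3 rfl
      refine ⟨1 / 2, (p - 1) / 2, ⟨by norm_num, by norm_num, Or.inr ⟨rfl, rfl⟩⟩, by linarith,
        by linarith, ?_⟩
      have h1 : 3 - p ≠ 0 := by linarith
      have h2 : 1 - (p - 1) / 2 = (3 - p) / 2 := by ring
      rw [h2]
      simp [DNLKG.growthExponent]
  obtain ⟨C, -, hC⟩ := DNLKG.exists_phaseSq_le hp hθ hθα hα1 (r := |R| + 1) (by positivity)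
  refine ⟨C, fun h hh u₀ u₁ _ _ hR T hT u v hs t ht => ?_⟩
  have hnorm : ∀ τ ∈ Set.Icc 0 T, DNLKG.phaseNorm h (u τ) (v τ) ^ 2
      = h ^ d * DNLKG.phaseSq h (DNLKG.toL2 (u τ)) (DNLKG.toL2 (v τ)) := fun τ hτ => by
    rw [DNLKG.phaseSq, ← DNLKG.phaseNorm_sq hh, DNLKG.coe_toL2 (hs.continuous_fst.1 τ hτ).1,
      DNLKG.coe_toL2 (hs.continuous_snd.1 τ hτ).1]
  have hpos : ∀ τ, 0 ≤ DNLKG.phaseNorm h (u τ) (v τ) := fun τ => Real.sqrt_nonneg _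
  have h0 : DNLKG.phaseNorm h (u 0) (v 0) ≤ |R| + 1 := by
    rw [hs.initial_fst, hs.initial_snd]
    linarith [le_abs_self R]
  have hmain := hC h T hh _ _ (hs.isStrongSolution hp hh hT.le) (by
    rw [← hnorm 0 (Set.left_mem_Icc.2 hT.le)]
    exact pow_le_pow_left₀ (hpos 0) h0 2) t ht
  rwa [← hnorm t ht, Real.sqrt_sq (hpos t), ← hexp] at hmain
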